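/- Let $n\ge 1$, let $V=\langle e_1,\dots,e_n\rangle$ be an $n$-dimensional complex vector space, and let $\mathcal V=\Lambda^{\infty/2}(V\otimes\mathbb C[z^{-1},z])$ be the space spanned by the semi-infinite wedge products of vectors $e_iz^d$ whose tail is a tail of the vacuum vector $|0\rangle=(e_1z^0)\wedge\cdots\wedge(e_nz^0)\wedge(e_1z^1)\wedge\cdots$; these wedge products, with their factors in the order in which the $e_iz^d$ are listed by $d$ and then by $i$, form an orthonormal basis for the bilinear pairing $\langle\cdot|\cdot\rangle$, and $\partial_{(e_iz^d)}$ denotes contraction. A matrix series $B=\sum_{k\ge0}B_kz^k$ or $B=\sum_{k\ge 0}B_kz^{-k}$ with $B_k\in\mathrm{End}(V)$ is called symplectic if $B^t(-z)B(z)=\mathrm{Id}\cdot z^0$. It acts on $\mathcal V$ by $v_1\wedge v_2\wedge\cdots\mapsto Bv_1\wedge Bv_2\wedge\cdots$, i.e. its matrix elements are the corresponding minors, normalized by $\langle0|B|0\rangle=1$. Let $A$ be a finite product of such operators, where a product of two operators is formed when the right one has finitely supported columns or the left one has finitely supported rows in the above basis (for instance $A=A_-(z^{-1})A_+(z)$).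 An element $mz^k$ with $m\in\mathrm{End}(V)$ acts on $\mathcal V$ by the Leibniz rule; let $\alpha_i=E_{ii}z$, let $u_1,\dots,u_n$ be formal variables, $\mathcal A=\exp(\sum_i\alpha_iu_i)A$, and assume that the formal power series $\langle 0|\mathcal A|0\rangle$ in $u_1,\dots,u_n$ is not zero. In the fraction field of $\mathbb C[[u_1,\dots,u_n]]$ put $$\gamma_{ij}(A)=-\frac{\big\langle (e_iz^{-1})\wedge\partial_{(e_jz^0)}|0\rangle\,\big|\,\mathcal A\,\big|\,|0\rangle\big\rangle}{\langle0|\mathcal A|0\rangle}\quad(i\ne j),\qquad (\Psi_d)_{ij}(A)=\frac{\big\langle (e_iz^{-1})\wedge|0\rangle\,\big|\,\mathcal A\,\big|\,(e_jz^{-1-d})\wedge|0\rangle\big\rangle}{\langle0|\mathcal A|0\rangle}\quad(d\ge0).$$ The same formula defines $\gamma_{ij}$ of the formal family $A\exp(\epsilon X)$ as a power series in the formal variable $\epsilon$. Write $\mathsf{n.d.}$ for a matrix considered up to its diagonal entries. Let $\ell\ge0$, and let $r$, $s$ be complex $n\times n$ matrices that are symmetric if $\ell$ is odd and skew-symmetric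 if $\ell$ is even. Then $$\left.\frac{\partial}{\partial\epsilon}\right|_{\epsilon=0}\mathsf{n.d.}\,\gamma\big(A\exp(\epsilon\, r z^{-\ell})\big)=\mathsf{n.d.}\sum_{i+j=\ell-1}(-1)^{j-1}\,\Psi_i(A)\,r\,\Psi_j^t(A),$$ where the sum is over integers $i,j\ge 0$ (it is empty for $\ell=0$), and $$\left.\frac{\partial}{\partial\epsilon}\right|_{\epsilon=0}\mathsf{n.d.}\,\gamma\big(A\exp(\epsilon\, s z^{\ell})\big)=0.$$ -/

import Mathlib

noncomputable section

namespace VanDeLeur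

/-- The basis vectors `e_i z^d` of `V ⊗ ℂ[z⁻¹, z]`, `V = ⟨e_1, …, e_n⟩`. The order is the one in
which they occur in the vacuum vector: first by the power `d`, then by the index `i`. -/
abbrev Mode (n : ℕ) : Type := ℤ ×ₗ Fin n

/-- The basis vector `e_i z^d`. -/
def mode {n : ℕ} (i : Fin n) (d : ℤ) : Mode n := toLex (d, i)

/-- The power of `z` in a basis vector. -/
def deg {n : ℕ} (p : Mode n) : ℤ := (ofLex p).1

/-- The index `i` of a basis vector `e_i z^d`. -/
def idx {n : ℕ} (p : Mode n) : Fin n := (ofLex p).2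

/-- The set of factors of a semi-infinite wedge product whose tail is a tail of the vacuum vector:
the powers of `z` are bounded below, and all basis vectors of sufficiently large power occur.
The set stands for the wedge product of its elements in increasing order. -/
@[ext]
structure Maya (n : ℕ) where
  carrier : Set (Mode n)
  bounded_below : ∃ a : ℤ, ∀ p ∈ carrier, a ≤ deg p
  tail : ∃ b : ℤ, ∀ p, b ≤ deg p → p ∈ carrier

namespace Maya

variable {n : ℕ}

/-- The factors of the vacuum vector: all `e_i z^d` with `d ≥ 0`. -/
def vacuum : Maya n where
  carrier := {p | 0 ≤ deg p}
  bounded_below := ⟨0, fun _ hp => hp⟩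
  tail := ⟨0, fun _ hp => hp⟩

/-- Add a factor. -/
def insert (p : Mode n) (v : Maya n) : Maya n where
  carrier := Insert.insert p v.carrier
  bounded_below := by
    obtain ⟨a, ha⟩ := v.bounded_below
    refine ⟨min a (deg p), fun q hq => ?_⟩
    rcases hq with rfl | hq
    · exact min_le_right _ _
    · exact (min_le_left _ _).trans (ha q hq)
  tail := by
    obtain ⟨b, hb⟩ := v.tail
    exact ⟨b, fun q hq => Set.mem_insert_of_mem _ (hb q hq)⟩

/-- Remove a factor. -/
def erase (p : Mode n) (v : Maya n) : Maya n where
  carrier := v.carrier \ {p}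
  bounded_below := by
    obtain ⟨a, ha⟩ := v.bounded_below
    exact ⟨a, fun q hq => ha q hq.1⟩
  tail := by
    obtain ⟨b, hb⟩ := v.tail
    refine ⟨max b (deg p + 1), fun q hq => ⟨hb q ((le_max_left _ _).trans hq), ?_⟩⟩
    rintro rfl
    have := (le_max_right b (deg q + 1)).trans hq
    omega

theorem below_finite (v : Maya n) (N : ℕ) :
    {p : Mode n | p ∈ v.carrier ∧ deg p < (N : ℤ)}.Finite := by
  obtain ⟨a, ha⟩ := v.bounded_below
  refine (((Set.finite_Icc a (N : ℤ)).prod (Set.finite_univ (α := Fin n))).image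
    (toLex : ℤ × Fin n → Mode n)).subset ?_
  rintro p ⟨hp, hN⟩
  exact ⟨ofLex p, ⟨⟨ha p hp, hN.le⟩, Set.mem_univ _⟩, rfl⟩

/-- The finitely many factors with power of `z` less than `N`. -/
def below (v : Maya n) (N : ℕ) : Finset (Mode n) := (v.below_finite N).toFinset

/-- The sign `(-1)^k`, where `k` is the number of factors that stand before the place of `p`. -/
def sign (p : Mode n) (v : Maya n) : ℂ := (-1) ^ {q ∈ v.carrier | q < p}.ncard

end Maya

/-- The space `Λ^{∞/2}(V ⊗ ℂ[z⁻¹, z])`. -/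
abbrev Fock (n : ℕ) : Type := Maya n →₀ ℂ

variable {n : ℕ}

/-- The vacuum vector `|0⟩`. -/
def vac : Fock n := Finsupp.single Maya.vacuum 1

open Classical in
/-- Exterior multiplication `ω ↦ p ∧ ω` by a basis vector `p`. -/
def wedge (p : Mode n) : Fock n →ₗ[ℂ] Fock n :=
  Finsupp.linearCombination ℂ fun v =>
    if p ∈ v.carrier then 0 else Finsupp.single (v.insert p) (v.sign p)

open Classical in
/-- The contraction `ω ↦ ∂_p ω`. -/
def contract (p : Mode n) : Fock n →ₗ[ℂ] Fock n :=
  Finsupp.linearCombination ℂ fun v =>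
    if p ∈ v.carrier then Finsupp.single (v.erase p) (v.sign p) else 0

/-- The extension by the Leibniz rule to the semi-infinite wedge space of the operator `m z^k`,
that is, `e_j z^d ↦ ∑ i, m i j • e_i z^(d+k)`. On a wedge product only finitely many `d` contribute
if `k ≠ 0` or `m` has trace `0`. -/
def leibniz (m : Matrix (Fin n) (Fin n) ℂ) (k : ℤ) : Fock n →ₗ[ℂ] Fock n :=
  Finsupp.linearCombination ℂ fun v =>
    ∑ᶠ d : ℤ, ∑ i, ∑ j, m i j • wedge (mode i (d + k)) (contract (mode j d) (Finsupp.single v 1))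

/-- The operator `α_i`, the Leibniz extension of `e_j z^d ↦ δ_{ij} e_j z^(d+1)`. -/
def alpha (i : Fin n) : Module.End ℂ (Fock n) := leibniz (Matrix.single i i 1) 1

/-- The coefficient at the monomial `u^m` of `exp (∑ i, α_i u_i)` (the `α_i` commute). -/
def expAlpha (m : Fin n →₀ ℕ) : Module.End ℂ (Fock n) :=
  (List.ofFn fun i : Fin n => ((m i).factorial : ℂ)⁻¹ • alpha i ^ m i).prod

/-- An operator given by its matrix elements `⟨w| M |v⟩`. The image of a vector may be
an infinite combination of basis vectors. -/
abbrev Op (n : ℕ) : Type := Maya n → Maya n → ℂ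

/-- The symplectic condition `B^t(-z) B(z) = Id · z⁰` for `B(z) = ∑ k, B k z^k`; for a series in
`z⁻¹` the condition on the coefficients is the same. -/
def IsSymplecticSeries (B : ℕ → Matrix (Fin n) (Fin n) ℂ) : Prop :=
  ∀ m : ℕ, ∑ p ∈ Finset.HasAntidiagonal.antidiagonal m, (-1 : ℂ) ^ p.1 • ((B p.1).transpose * B p.2) =
    if m = 0 then 1 else 0

/-- The coefficient at `p` of the image of the basis vector `q` under `∑ k, B k z^k`. -/
def plusEntry (B : ℕ → Matrix (Fin n) (Fin n) ℂ) (p q : Mode n) : ℂ :=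
  if deg q ≤ deg p then B (deg p - deg q).toNat (idx p) (idx q) else 0

/-- The coefficient at `p` of the image of the basis vector `q` under `∑ k, B k z^(-k)`. -/
def minusEntry (B : ℕ → Matrix (Fin n) (Fin n) ℂ) (p q : Mode n) : ℂ :=
  if deg p ≤ deg q then B (deg q - deg p).toNat (idx p) (idx q) else 0

/-- The minor of `T` with rows `P` and columns `Q`, both in increasing order. -/
def minor (T : Mode n → Mode n → ℂ) (P Q : Finset (Mode n)) : ℂ :=
  if h : P.card = Q.card then
    Matrix.det (Matrix.of fun a b : Fin Q.card =>
      T (P.orderEmbOfFin h a) (Q.orderEmbOfFin rfl b))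
  else 0

open Classical in
/-- The value that a sequence takes for all large `N` (and `0` if there is none). -/
def eventualValue (f : ℕ → ℂ) : ℂ :=
  if h : ∃ c, ∀ᶠ N in Filter.atTop, f N = c then h.choose else 0

/-- The action `v₁ ∧ v₂ ∧ ⋯ ↦ T v₁ ∧ T v₂ ∧ ⋯` of an invertible series in `z` or in `z⁻¹` on the
semi-infinite wedge space. The matrix element `⟨w| T |v⟩` is the minor of `T` with rows `w` and
columns `v`, normalized by `⟨0| T |0⟩ = 1`; for such a series the quotients of truncated
minors do not depend on `N` from some `N` on. -/
def groupOp (T : Mode n → Mode n → ℂ) : Op n := fun w v =>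
  eventualValue fun N =>
    minor T (w.below N) (v.below N) /
      minor T ((Maya.vacuum : Maya n).below N) ((Maya.vacuum : Maya n).below N)

/-- The operators `A`: finite products of (the actions of) series in `z` and series in `z⁻¹` with
the symplectic condition. The product of two operators is formed where it makes sense for formal
series: where the second factor maps every basis vector to a finite combination of basis vectors,
or the transpose of the first one does. -/
inductive IsSymplecticOp : Op n → Prop
  | plus (B : ℕ → Matrix (Fin n) (Fin n) ℂ) (hB : IsSymplecticSeries B) :
      IsSymplecticOp (groupOp (plusEntry B))
  | minus (B : ℕ → Matrix (Fin n) (Fin n) ℂ) (hB : IsSymplecticSeries B) :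
      IsSymplecticOp (groupOp (minusEntry B))
  | mul (M M' : Op n) (hM : IsSymplecticOp M) (hM' : IsSymplecticOp M')
      (hfin : (∀ w, {x | M w x ≠ 0}.Finite) ∨ (∀ v, {x | M' x v ≠ 0}.Finite)) :
      IsSymplecticOp (fun w v => ∑ᶠ x, M w x * M' x v)

/-- The bilinear pairing in which the wedge products of basis vectors are orthonormal. -/
def pairing (a b : Fock n) : ℂ := a.sum fun w c => c * b w

/-- The matrix element `⟨a| exp (∑ i, α_i u_i) A |b⟩`, a formal power series in `u_1, …, u_n`.
Each coefficient is a finite sum over the basis vectors `x`. -/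
def matrixElement (A : Op n) (a b : Fock n) : MvPowerSeries (Fin n) ℂ := fun m =>
  ∑ᶠ x : Maya n, pairing a (expAlpha m (Finsupp.single x 1)) * b.sum fun y c => A x y * c

/-- The field of fractions of the ring of formal power series in `u_1, …, u_n`. -/
abbrev K (n : ℕ) : Type := FractionRing (MvPowerSeries (Fin n) ℂ)

/-- The wave function matrices
`(Ψ_d)_{ij} = ⟨(e_i z⁻¹) ∧ |0⟩| 𝒜 |(e_j z^(-1-d)) ∧ |0⟩⟩ / ⟨0| 𝒜 |0⟩`. -/
def Psi (A : Op n) (d : ℕ) : Matrix (Fin n) (Fin n) (K n) := Matrix.of fun i j =>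
  algebraMap (MvPowerSeries (Fin n) ℂ) (K n)
      (matrixElement A (wedge (mode i (-1)) vac) (wedge (mode j (-1 - (d : ℤ))) vac)) /
    algebraMap (MvPowerSeries (Fin n) ℂ) (K n) (matrixElement A vac vac)

/-- The formal family `A exp (ε X)` of operators, as the sequence of its coefficients at `ε^k`,
where `X` is an operator on the semi-infinite wedge space. -/
def expDeformation (A : Op n) (X : Module.End ℂ (Fock n)) : ℕ → Op n := fun k w v =>
  (((k.factorial : ℂ)⁻¹ • X ^ k) (Finsupp.single v 1)).sum fun y c => A w y * c

/-- The matrix element of a formal family `∑ k, F k ε^k`, a power series in `ε`. -/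
def familyElement (F : ℕ → Op n) (a b : Fock n) : PowerSeries (K n) := PowerSeries.mk fun k =>
  algebraMap (MvPowerSeries (Fin n) ℂ) (K n) (matrixElement (F k) a b)

/-- The matrix `γ` of a formal family of operators:
`γ_{ij} = - ⟨(e_i z⁻¹) ∧ ∂_{e_j z⁰} |0⟩| 𝒜 |0⟩ / ⟨0| 𝒜 |0⟩`, a power series in `ε`. Only its
entries with `i ≠ j` are of interest. -/
def gamma (F : ℕ → Op n) : Matrix (Fin n) (Fin n) (PowerSeries (K n)) := Matrix.of fun i j =>
  -(familyElement F (wedge (mode i (-1)) (contract (mode j 0) vac)) vac) *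
    (familyElement F vac vac)⁻¹

/-- The derivative at `ε = 0`. -/
def ddε (f : PowerSeries (K n)) : K n :=
  PowerSeries.constantCoeff (PowerSeries.derivative (K n) f)

/-- Equality `n.d. M = n.d. M'` of matrices with non-specified diagonal. -/
def NDEq {R : Type*} (M M' : Matrix (Fin n) (Fin n) R) : Prop :=
  ∀ i j, i ≠ j → M i j = M' i j

/-- Symmetric for odd `ℓ`, skew-symmetric for even `ℓ`. -/
def HasParity (ℓ : ℕ) (m : Matrix (Fin n) (Fin n) ℂ) : Prop :=
  (Odd ℓ → m.transpose = m) ∧ (Even ℓ → m.transpose = -m)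

end VanDeLeur

end

/-!
A symplectic operator `A` is the action of matrices `T` preserving the form `∑ (-1)^d p_d ∧ p*_d`
(with `p* = e_i z^(-1-d)` for `p = e_i z^d`), so `A ⊗ A` commutes both with `∑ p ∧ ⊗ ∂_p`, as for
every `T`, and with `∑ ± p ∧ ⊗ p* ∧`. Truncated minors turn the two statements into identities of
finite determinants. Both operators also commute with the `α_i`, hence with
`exp (∑ i, α_i u_i)`. The first invariance, evaluated between `∂_q |0⟩ ⊗ p ∧ |0⟩` and
`p' ∧ ∂_q' |0⟩ ⊗ |0⟩`, is a Plücker relation that factorises the variation of `γ` into matrix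
elements `⟨∂_q' 0| 𝒜 |∂_q 0⟩` and `⟨p' ∧ 0| 𝒜 |p ∧ 0⟩`; the second identifies the former with
`± ⟨q'* ∧ 0| 𝒜 |q* ∧ 0⟩`. Both factors are then entries of the `Ψ_d`. Finally `r z^(-ℓ)` moves only
the `ℓ` lowest powers of `z` out of the vacuum, while `s z^ℓ` annihilates it.
-/

noncomputable section

namespace VanDeLeur

open Filter TensorProduct
open LinearMap (BilinForm IsAdjointPair)

section Forms

variable {R ι : Type*} [CommSemiring R]

/-- The bilinear form with matrix `M`. The matrix may have infinitely many nonzero entries in every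
row and column, so that there need not be an endomorphism with this matrix. -/
def matrixForm (M : ι → ι → R) : BilinForm R (ι →₀ R) :=
  Finsupp.linearCombination R fun i => Finsupp.linearCombination R (M i)

/-- The bilinear form for which the standard basis is orthonormal. -/
def dotForm : BilinForm R (ι →₀ R) := Finsupp.linearCombination R Finsupp.lapply

theorem matrixForm_single (M : ι → ι → R) (i j : ι) (c d : R) :
    matrixForm M (Finsupp.single i c) (Finsupp.single j d) = c * (d * M i j) := by
  simp [matrixForm]

theorem matrixForm_apply (M : ι → ι → R) (a b : ι →₀ R) :
    matrixForm M a b = a.sum fun i c => c * b.sum fun j d => M i j * d := by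
  simp only [matrixForm, Finsupp.linearCombination_apply, Finsupp.sum, LinearMap.sum_apply,
    LinearMap.smul_apply, smul_eq_mul, mul_comm (M _ _)]

theorem matrixForm_flip (M : ι → ι → R) : LinearMap.flip (matrixForm M) = matrixForm (flip M) := by
  ext i j
  simp [matrixForm_single, flip]

theorem dotForm_single_left (i : ι) (c : R) (b : ι →₀ R) :
    dotForm (Finsupp.single i c) b = c * b i := by
  simp [dotForm]

theorem dotForm_single_right (a : ι →₀ R) (i : ι) (c : R) :
    dotForm a (Finsupp.single i c) = c * a i := by
  induction a using Finsupp.induction_linear with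
  | zero => simp
  | add f g hf hg => simp [hf, hg, mul_add]
  | single j d =>
    classical
    rw [dotForm_single_left, Finsupp.single_apply, Finsupp.single_apply]
    split_ifs <;> grind

theorem dotForm_flip : LinearMap.flip (dotForm : BilinForm R (ι →₀ R)) = dotForm := by
  refine LinearMap.ext fun a => Finsupp.lhom_ext fun i c => ?_
  rw [LinearMap.flip_apply, dotForm_single_left, dotForm_single_right]

theorem dotForm_comm (a b : ι →₀ R) : dotForm a b = dotForm b a :=
  LinearMap.congr_fun₂ dotForm_flip b a

theorem dotForm_tmul_single_left (i j : ι) (t : (ι →₀ R) ⊗[R] (ι →₀ R)) :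
    BilinForm.tmul dotForm dotForm (Finsupp.single i 1 ⊗ₜ Finsupp.single j 1) t =
      finsuppTensorFinsupp' R ι ι t (i, j) := by
  induction t using TensorProduct.induction_on with
  | zero => simp
  | add x y hx hy => simp [hx, hy]
  | tmul f g => simp [dotForm_single_left, finsuppTensorFinsupp'_apply_apply, mul_comm]

theorem flip_dotForm_tmul_injective :
    Function.Injective (LinearMap.flip (BilinForm.tmul (dotForm : BilinForm R (ι →₀ R))
      (dotForm : BilinForm R (ι →₀ R)))) := by
  refine fun t t' h => (finsuppTensorFinsupp' R ι ι).injective (Finsupp.ext fun ⟨i, j⟩ => ?_)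
  rw [← dotForm_tmul_single_left, ← dotForm_tmul_single_left]
  exact LinearMap.congr_fun h _

/-- The endomorphism whose matrix is a matrix `M` with finitely supported columns. -/
def columnMap (M : ι → ι → R) (hM : ∀ j, {i | M i j ≠ 0}.Finite) : Module.End R (ι →₀ R) :=
  Finsupp.linearCombination R fun j => Finsupp.ofSupportFinite (fun i => M i j) (hM j)

theorem dotForm_compl₂_columnMap {M : ι → ι → R} (hM : ∀ j, {i | M i j ≠ 0}.Finite) :
    dotForm.compl₂ (columnMap M hM) = matrixForm M := by
  ext i j
  simp only [LinearMap.coe_comp, Function.comp_apply, Finsupp.lsingle_apply,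
    LinearMap.compl₂_apply, columnMap, Finsupp.linearCombination_single, one_smul,
    dotForm_single_left, matrixForm_single, one_mul]
  rfl

theorem matrixForm_compl₂_columnMap (M : ι → ι → R) {M' : ι → ι → R}
    (hM' : ∀ j, {i | M' i j ≠ 0}.Finite) :
    (matrixForm M).compl₂ (columnMap M' hM') =
      matrixForm fun i j => ∑ᶠ k, M i k * M' k j := by
  ext i j
  have hfin := finsum_eq_sum_of_support_subset (fun k => M i k * M' k j)
    (s := (hM' j).toFinset) fun k hk => by simpa using right_ne_zero_of_mul hk
  simp only [LinearMap.coe_comp, Function.comp_apply, Finsupp.lsingle_apply,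
    LinearMap.compl₂_apply, columnMap, Finsupp.linearCombination_single, one_smul,
    matrixForm_single, one_mul, hfin]
  rw [matrixForm_apply, Finsupp.sum_single_index (by simp), one_mul]
  rfl

end Forms

section TensorSquare

variable {R V : Type*} [CommSemiring R] [AddCommMonoid V] [Module R V]

theorem tmul_apply_tmul (B : BilinForm R V) (a a' b b' : V) :
    B.tmul B (a ⊗ₜ a') (b ⊗ₜ b') = B a b * B a' b' :=
  mul_comm _ _

theorem tmul_flip (B : BilinForm R V) :
    LinearMap.flip (B.tmul B) = BilinForm.tmul (LinearMap.flip B) (LinearMap.flip B) := by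
  ext a a' b b'
  simp

theorem tmul_compl₂ (B : BilinForm R V) (L : Module.End R V) :
    (B.tmul B).compl₂ (TensorProduct.map L L) =
      BilinForm.tmul (B.compl₂ L) (B.compl₂ L) := by
  ext a a' b b'
  simp

/-- For the form `a, b ↦ ⟨a| M |b⟩` of an operator `M`, this says that `M ⊗ M` commutes with `Ω`,
where `Ωt` is the transpose of `Ω`. -/
def Intertwines (Ωt Ω : Module.End R (V ⊗[R] V)) (B : BilinForm R V) : Prop :=
  IsAdjointPair (B.tmul B) (B.tmul B) Ωt Ω

theorem Intertwines.flip {Ωt Ω : Module.End R (V ⊗[R] V)} {B : BilinForm R V}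
    (h : Intertwines Ωt Ω B) : Intertwines Ω Ωt (LinearMap.flip B) := by
  rw [Intertwines, ← tmul_flip]
  exact fun s t => (h t s).symm

theorem Intertwines.compl₂ {Ωt Ω : Module.End R (V ⊗[R] V)} {B : BilinForm R V}
    (h : Intertwines Ωt Ω B) {L : Module.End R V} (hL : Commute (TensorProduct.map L L) Ω) :
    Intertwines Ωt Ω (B.compl₂ L) := by
  rw [Intertwines, ← tmul_compl₂]
  intro s t
  rw [LinearMap.compl₂_apply, LinearMap.compl₂_apply, h, ← Module.End.mul_apply, ← hL.eq,
    Module.End.mul_apply]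

theorem Intertwines.commute_map {Ωt Ω : Module.End R (V ⊗[R] V)} {B : BilinForm R V}
    (hB : Function.Injective (LinearMap.flip (B.tmul B))) (h : Intertwines Ωt Ω B)
    {L : Module.End R V} (hL : Intertwines Ωt Ω (B.compl₂ L)) :
    Commute (TensorProduct.map L L) Ω := by
  rw [Intertwines, ← tmul_compl₂] at hL
  refine LinearMap.ext fun t => hB (LinearMap.ext fun s => ?_)
  simp only [LinearMap.flip_apply, Module.End.mul_apply]
  exact (hL s t).symm.trans (h s _)

end TensorSquare

section MatrixProduct

variable {R ι : Type*} [CommSemiring R] {M M' : ι → ι → R}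
  {Ωt Ω : Module.End R ((ι →₀ R) ⊗[R] (ι →₀ R))}

theorem intertwines_finsum_mul_of_finite_columns (h₁ : Intertwines Ωt Ω dotForm)
    (hM : Intertwines Ωt Ω (matrixForm M)) (hM' : Intertwines Ωt Ω (matrixForm M'))
    (hfin : ∀ j, {i | M' i j ≠ 0}.Finite) :
    Intertwines Ωt Ω (matrixForm fun i j => ∑ᶠ k, M i k * M' k j) := by
  rw [← dotForm_compl₂_columnMap hfin] at hM'
  rw [← matrixForm_compl₂_columnMap M hfin]
  exact hM.compl₂ (h₁.commute_map flip_dotForm_tmul_injective hM')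

theorem intertwines_finsum_mul_of_finite_rows (h₁ : Intertwines Ωt Ω dotForm)
    (hM : Intertwines Ωt Ω (matrixForm M)) (hM' : Intertwines Ωt Ω (matrixForm M'))
    (hfin : ∀ i, {j | M i j ≠ 0}.Finite) :
    Intertwines Ωt Ω (matrixForm fun i j => ∑ᶠ k, M i k * M' k j) := by
  have h := intertwines_finsum_mul_of_finite_columns (M := flip M') (M' := flip M)
    (by simpa only [dotForm_flip] using h₁.flip) (by simpa only [matrixForm_flip] using hM'.flip)
    (by simpa only [matrixForm_flip] using hM.flip) hfin
  have h' := h.flip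
  rw [matrixForm_flip] at h'
  exact (funext₂ fun i j => finsum_congr fun k => mul_comm _ _ :
    flip _ = fun i j => ∑ᶠ k, M i k * M' k j) ▸ h'

end MatrixProduct

variable {n : ℕ}

theorem deg_mode (i : Fin n) (d : ℤ) : deg (mode i d) = d := rfl

theorem idx_mode (i : Fin n) (d : ℤ) : idx (mode i d) = i := rfl

theorem mode_idx_deg (p : Mode n) : mode (idx p) (deg p) = p := rfl

theorem mode_inj {i j : Fin n} {d e : ℤ} : mode i d = mode j e ↔ i = j ∧ d = e :=
  ⟨fun h => ⟨congrArg idx h, congrArg deg h⟩, by rintro ⟨rfl, rfl⟩; rfl⟩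

theorem deg_le_of_le {p q : Mode n} (h : p ≤ q) : deg p ≤ deg q :=
  Prod.Lex.monotone_fst p q h

theorem lt_of_deg_lt {p q : Mode n} (h : deg p < deg q) : p < q :=
  Prod.Lex.lt_iff.2 (Or.inl h)

theorem finite_deg_mem_Icc (a b : ℤ) : {p : Mode n | a ≤ deg p ∧ deg p ≤ b}.Finite := by
  refine (((Set.finite_Icc a b).prod (Set.finite_univ (α := Fin n))).image
    (toLex : ℤ × Fin n → Mode n)).subset ?_
  rintro p ⟨hp, hN⟩
  exact ⟨ofLex p, ⟨⟨hp, hN⟩, Set.mem_univ _⟩, rfl⟩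

namespace Maya

theorem mem_insert {p q : Mode n} {v : Maya n} :
    q ∈ (v.insert p).carrier ↔ q = p ∨ q ∈ v.carrier := Iff.rfl

theorem mem_erase {p q : Mode n} {v : Maya n} :
    q ∈ (v.erase p).carrier ↔ q ∈ v.carrier ∧ q ≠ p := Iff.rfl

theorem mem_vacuum {p : Mode n} : p ∈ (vacuum : Maya n).carrier ↔ 0 ≤ deg p := Iff.rfl

theorem ext_mem {v w : Maya n} (h : ∀ p, p ∈ v.carrier ↔ p ∈ w.carrier) : v = w :=
  Maya.ext (Set.ext h)

theorem insert_erase {p : Mode n} {v : Maya n} (h : p ∈ v.carrier) :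
    (v.erase p).insert p = v := by
  apply ext_mem
  intro q
  simp only [mem_insert, mem_erase]
  grind

theorem erase_insert {p : Mode n} {v : Maya n} (h : p ∉ v.carrier) :
    (v.insert p).erase p = v := by
  apply ext_mem
  intro q
  simp only [mem_insert, mem_erase]
  grind

theorem insert_insert_comm (p q : Mode n) (v : Maya n) :
    (v.insert p).insert q = (v.insert q).insert p := by
  apply ext_mem
  intro r
  simp only [mem_insert]
  tauto

theorem erase_insert_comm {p q : Mode n} (h : p ≠ q) (v : Maya n) :
    (v.insert p).erase q = (v.erase q).insert p := by
  apply ext_mem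
  intro r
  simp only [mem_erase, mem_insert]
  grind

theorem finite_before (v : Maya n) (p : Mode n) : {q ∈ v.carrier | q < p}.Finite := by
  obtain ⟨a, ha⟩ := v.bounded_below
  exact (finite_deg_mem_Icc a (deg p)).subset fun q hq => ⟨ha q hq.1, deg_le_of_le hq.2.le⟩

theorem sign_insert {p q : Mode n} {v : Maya n} (h : q ∉ v.carrier) :
    (v.insert q).sign p = (if q < p then -1 else 1) * v.sign p := by
  unfold sign
  split_ifs with hqp
  · have : {r ∈ (v.insert q).carrier | r < p} = Insert.insert q {r ∈ v.carrier | r < p} := by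
      ext r
      simp only [Set.mem_ofPred_eq, mem_insert, Set.mem_insert_iff]
      grind
    rw [this, Set.ncard_insert_of_notMem (fun hq => h hq.1) (v.finite_before p), pow_succ]
    ring
  · have : {r ∈ (v.insert q).carrier | r < p} = {r ∈ v.carrier | r < p} := by
      ext r
      simp only [Set.mem_ofPred_eq, mem_insert]
      grind
    rw [this, one_mul]

theorem sign_erase {p q : Mode n} {v : Maya n} (h : q ∈ v.carrier) :
    (v.erase q).sign p = (if q < p then -1 else 1) * v.sign p := by
  have := sign_insert (p := p) (q := q) (v := v.erase q) (fun hq => hq.2 rfl)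
  rw [insert_erase h] at this
  rw [this]
  split_ifs <;> simp

theorem sign_mul_self (p : Mode n) (v : Maya n) : v.sign p * v.sign p = 1 := by
  unfold sign
  rw [← mul_pow]
  simp

end Maya

open Maya

open Classical in
theorem wedge_single (p : Mode n) (v : Maya n) (c : ℂ) :
    wedge p (Finsupp.single v c) =
      if p ∈ v.carrier then 0 else Finsupp.single (v.insert p) (c * v.sign p) := by
  rw [wedge, Finsupp.linearCombination_single]
  split_ifs <;> simp

open Classical in
theorem contract_single (p : Mode n) (v : Maya n) (c : ℂ) :
    contract p (Finsupp.single v c) =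
      if p ∈ v.carrier then Finsupp.single (v.erase p) (c * v.sign p) else 0 := by
  rw [contract, Finsupp.linearCombination_single]
  split_ifs <;> simp

theorem wedge_wedge (p q : Mode n) (f : Fock n) :
    wedge p (wedge q f) = -wedge q (wedge p f) := by
  classical
  suffices h : wedge p ∘ₗ wedge q = -(wedge q ∘ₗ wedge p) from LinearMap.congr_fun h f
  ext1 v
  ext1
  simp only [LinearMap.comp_apply, LinearMap.neg_apply, Finsupp.lsingle_apply, wedge_single]
  by_cases hp : p ∈ v.carrier <;> by_cases hq : q ∈ v.carrier <;>
    simp only [hp, hq, if_true, if_false, wedge_single, map_zero, neg_zero, mem_insert, or_true]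
  by_cases hpq : p = q
  · simp [hpq]
  · rw [if_neg (by tauto), if_neg (by tauto), sign_insert hp, sign_insert hq,
      insert_insert_comm, ← Finsupp.single_neg]
    congr 1
    rcases lt_or_gt_of_ne hpq with h | h <;> simp [h, h.not_gt, mul_comm]

theorem isAdjointPair_wedge_contract (p : Mode n) :
    IsAdjointPair dotForm dotForm (wedge p) (contract p) := by
  classical
  rw [LinearMap.isAdjointPair_iff_comp_eq_compl₂]
  ext v w
  simp only [LinearMap.comp_apply, Finsupp.lsingle_apply, LinearMap.compl₂_apply, wedge_single,
    contract_single, one_mul]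
  by_cases hv : p ∈ v.carrier <;> by_cases hw : p ∈ w.carrier <;>
    simp only [hv, hw, if_true, if_false, map_zero, LinearMap.zero_apply, dotForm_single_left,
      Finsupp.single_apply]
  · rw [if_neg (by rintro rfl; exact hv.2 rfl), mul_zero]
  · by_cases h : w = v.insert p
    · rw [if_pos h, if_pos (h ▸ erase_insert hv), h, sign_insert hv]
      simp
    · rw [if_neg h, if_neg (by rintro rfl; exact h (insert_erase hw).symm), mul_zero, mul_zero]
  · rw [if_neg (by rintro rfl; exact hw (Or.inl rfl)), mul_zero]

theorem eq_of_dotForm_eq {f g : Fock n} (h : ∀ a, dotForm a f = dotForm a g) : f = g :=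
  Finsupp.ext fun v => by simpa only [dotForm_single_left, one_mul] using h (Finsupp.single v 1)

theorem contract_contract (p q : Mode n) (f : Fock n) :
    contract p (contract q f) = -contract q (contract p f) := by
  refine eq_of_dotForm_eq fun a => ?_
  simp only [map_neg, ← isAdjointPair_wedge_contract _ _ _, wedge_wedge q p, LinearMap.neg_apply]

theorem contract_wedge_self (p : Mode n) (f : Fock n) :
    contract p (wedge p f) = f - wedge p (contract p f) := by
  classical
  suffices h : contract p ∘ₗ wedge p = LinearMap.id - (wedge p ∘ₗ contract p) from
    LinearMap.congr_fun h f
  ext1 v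
  ext1
  simp only [LinearMap.comp_apply, LinearMap.sub_apply, Finsupp.lsingle_apply, contract_single,
    wedge_single, LinearMap.id_apply]
  by_cases hp : p ∈ v.carrier
  · simp [hp, wedge_single, mem_erase, insert_erase hp, sign_erase hp, sign_mul_self]
  · simp [hp, contract_single, mem_insert, erase_insert hp, sign_insert hp, sign_mul_self]

theorem contract_wedge {p q : Mode n} (hpq : p ≠ q) (f : Fock n) :
    contract p (wedge q f) = -wedge q (contract p f) := by
  classical
  suffices h : contract p ∘ₗ wedge q = -(wedge q ∘ₗ contract p) from LinearMap.congr_fun h f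
  ext1 v
  ext1
  simp only [LinearMap.comp_apply, LinearMap.neg_apply, Finsupp.lsingle_apply, contract_single,
    wedge_single]
  by_cases hp : p ∈ v.carrier <;> by_cases hq : q ∈ v.carrier <;>
    simp only [hp, hq, if_true, if_false, contract_single, wedge_single, map_zero, neg_zero,
      mem_erase, mem_insert, hpq, hpq.symm, or_true, or_false, true_and, false_and,
      ne_eq, not_false_eq_true]
  rw [sign_erase hp, sign_insert hq, erase_insert_comm hpq.symm, ← Finsupp.single_neg]
  congr 1
  rcases lt_or_gt_of_ne hpq with h | h <;> simp [h, h.not_gt, mul_comm]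

theorem exists_wedge_eq_zero (f : Fock n) : ∃ b : ℤ, ∀ p : Mode n, b ≤ deg p → wedge p f = 0 := by
  classical
  induction f using Finsupp.induction_linear with
  | zero => exact ⟨0, fun p _ => map_zero _⟩
  | add f g hf hg =>
    obtain ⟨b, hb⟩ := hf
    obtain ⟨c, hc⟩ := hg
    refine ⟨max b c, fun p hp => ?_⟩
    rw [map_add, hb p ((le_max_left _ _).trans hp), hc p ((le_max_right _ _).trans hp), add_zero]
  | single v c =>
    obtain ⟨b, hb⟩ := v.tail
    exact ⟨b, fun p hp => by rw [wedge_single, if_pos (hb p hp)]⟩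

theorem exists_contract_eq_zero (f : Fock n) :
    ∃ a : ℤ, ∀ p : Mode n, deg p < a → contract p f = 0 := by
  classical
  induction f using Finsupp.induction_linear with
  | zero => exact ⟨0, fun p _ => map_zero _⟩
  | add f g hf hg =>
    obtain ⟨b, hb⟩ := hf
    obtain ⟨c, hc⟩ := hg
    refine ⟨min b c, fun p hp => ?_⟩
    rw [map_add, hb p (hp.trans_le (min_le_left _ _)), hc p (hp.trans_le (min_le_right _ _)),
      add_zero]
  | single v c =>
    obtain ⟨a, ha⟩ := v.bounded_below
    refine ⟨a, fun p hp => ?_⟩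
    rw [contract_single, if_neg fun h => (ha p h).not_gt hp]

theorem wedge_vac {p : Mode n} (hp : 0 ≤ deg p) : wedge p vac = 0 := by
  rw [vac, wedge_single, if_pos (mem_vacuum.2 hp)]

theorem contract_vac {p : Mode n} (hp : deg p < 0) : contract p vac = 0 := by
  rw [vac, contract_single, if_neg fun h => (mem_vacuum.1 h).not_gt hp]

/-- The sign `(-1)^k`, where `k` is the number of elements of `P` before `p`, by which the element
`p` is moved to the front in an exterior product over `P`. -/
def finsetSign {α : Type*} [LinearOrder α] (p : α) (P : Finset α) : ℂ :=
  (-1) ^ (P.filter (· < p)).card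

theorem minor_eq_det {T : Mode n → Mode n → ℂ} {P Q : Finset (Mode n)} {k : ℕ}
    {f g : Fin k → Mode n} (hf : StrictMono f) (hg : StrictMono g)
    (hP : P.card = k) (hQ : Q.card = k) (hfP : ∀ a, f a ∈ P) (hgQ : ∀ a, g a ∈ Q) :
    minor T P Q = Matrix.det (Matrix.of fun a b => T (f a) (g b)) := by
  subst hQ
  rw [minor, dif_pos hP, Finset.orderEmbOfFin_unique hP hfP hf,
    Finset.orderEmbOfFin_unique rfl hgQ hg]

theorem minor_of_card_ne {T : Mode n → Mode n → ℂ} {P Q : Finset (Mode n)}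
    (h : P.card ≠ Q.card) : minor T P Q = 0 := by
  rw [minor, dif_neg h]

theorem minor_flip (T : Mode n → Mode n → ℂ) (P Q : Finset (Mode n)) :
    minor (flip T) P Q = minor T Q P := by
  by_cases h : P.card = Q.card
  · rw [minor_eq_det (P.orderEmbOfFin rfl).strictMono (Q.orderEmbOfFin h.symm).strictMono rfl h.symm
      (P.orderEmbOfFin_mem rfl) (Q.orderEmbOfFin_mem h.symm),
      minor_eq_det (Q.orderEmbOfFin h.symm).strictMono (P.orderEmbOfFin rfl).strictMono h.symm rfl
      (Q.orderEmbOfFin_mem h.symm) (P.orderEmbOfFin_mem rfl), ← Matrix.det_transpose]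
    rfl
  · rw [minor_of_card_ne h, minor_of_card_ne (Ne.symm h)]

theorem finsetSign_orderEmbOfFin {α : Type*} [LinearOrder α] (P : Finset α) {k : ℕ}
    (h : P.card = k) (i : Fin k) :
    finsetSign (P.orderEmbOfFin h i) P = (-1) ^ (i : ℕ) := by
  have : P.filter (· < P.orderEmbOfFin h i)
      = (Finset.Iio i).map (P.orderEmbOfFin h).toEmbedding := by
    ext p
    simp only [Finset.mem_filter, Finset.mem_map, Finset.mem_Iio]
    constructor
    · rintro ⟨hp, ha⟩
      obtain ⟨a, rfl⟩ : p ∈ Set.range (P.orderEmbOfFin h) := by simpa using hp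
      exact ⟨a, by simpa using ha, rfl⟩
    · rintro ⟨a, ha, rfl⟩
      exact ⟨P.orderEmbOfFin_mem h a, by simpa using ha⟩
  rw [finsetSign, this, Finset.card_map, Fin.card_Iio]

theorem sum_eq_sum_orderEmbOfFin {α M : Type*} [LinearOrder α] [AddCommMonoid M] (P : Finset α)
    {k : ℕ} (h : P.card = k) (F : α → M) : ∑ p ∈ P, F p = ∑ i, F (P.orderEmbOfFin h i) := by
  conv_lhs => rw [← P.map_orderEmbOfFin_univ h]
  rw [Finset.sum_map]
  rfl

theorem minor_erase_eq_det {T : Mode n → Mode n → ℂ} {P Q : Finset (Mode n)} {k : ℕ}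
    (hP : P.card = k + 1) (hQ : Q.card = k) (i : Fin (k + 1)) {g : Fin k → Mode n}
    (hg : StrictMono g) (hgQ : ∀ a, g a ∈ Q) :
    minor T (P.erase (P.orderEmbOfFin hP i)) Q =
      Matrix.det (Matrix.of fun a b => T (P.orderEmbOfFin hP (i.succAbove a)) (g b)) := by
  refine minor_eq_det (f := fun a => P.orderEmbOfFin hP (i.succAbove a))
    ((P.orderEmbOfFin hP).strictMono.comp (Fin.strictMono_succAbove i)) hg ?_ hQ ?_ hgQ
  · rw [Finset.card_erase_of_mem (P.orderEmbOfFin_mem hP i), hP, Nat.add_sub_cancel]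
  · intro a
    refine Finset.mem_erase.2 ⟨fun h => ?_, P.orderEmbOfFin_mem hP _⟩
    exact Fin.succAbove_ne i a ((P.orderEmbOfFin hP).injective h)

theorem sum_minor_erase_eq_det_insertNth (T : Mode n → Mode n → ℂ) {P Q : Finset (Mode n)} {k : ℕ}
    (hP : P.card = k + 1) (hQ : Q.card = k) (q : Mode n) (j : Fin (k + 1)) :
    ∑ p ∈ P, finsetSign p P * T p q * minor T (P.erase p) Q =
      (-1) ^ (j : ℕ) * Matrix.det (Matrix.of fun a b =>
        T (P.orderEmbOfFin hP a)
          (j.insertNth (α := fun _ => Mode n) q (Q.orderEmbOfFin hQ) b)) := by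
  have hsq : (-1 : ℂ) ^ (j : ℕ) * (-1) ^ (j : ℕ) = 1 := by rw [← mul_pow]; simp
  rw [sum_eq_sum_orderEmbOfFin P hP, Matrix.det_succ_column _ j, Finset.mul_sum]
  refine Finset.sum_congr rfl fun i _ => ?_
  rw [finsetSign_orderEmbOfFin, minor_erase_eq_det hP hQ i (Q.orderEmbOfFin hQ).strictMono
    (Q.orderEmbOfFin_mem hQ)]
  simp only [pow_add, Matrix.of_apply, Fin.insertNth_apply_same, ← mul_assoc,
    mul_right_comm _ _ ((-1 : ℂ) ^ (j : ℕ)), hsq, one_mul]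
  congr 2
  ext a b
  simp

theorem sum_minor_erase_of_card_ne (T : Mode n → Mode n → ℂ) {P Q : Finset (Mode n)}
    (h : P.card ≠ Q.card + 1) (q : Mode n) :
    ∑ p ∈ P, finsetSign p P * T p q * minor T (P.erase p) Q = 0 := by
  refine Finset.sum_eq_zero fun p hp => ?_
  rw [minor_of_card_ne, mul_zero]
  have := Finset.card_erase_add_one hp
  lia

theorem sum_minor_erase_of_mem (T : Mode n → Mode n → ℂ) (P : Finset (Mode n))
    {Q : Finset (Mode n)} {q : Mode n} (hq : q ∈ Q) :
    ∑ p ∈ P, finsetSign p P * T p q * minor T (P.erase p) Q = 0 := by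
  by_cases hP : P.card = Q.card + 1
  · obtain ⟨j, hj⟩ : q ∈ Set.range (Q.orderEmbOfFin rfl) := by simpa using hq
    rw [sum_minor_erase_eq_det_insertNth T hP rfl q 0,
      Matrix.det_zero_of_column_eq (Fin.succ_ne_zero j).symm fun a => by simp [hj], mul_zero]
  · exact sum_minor_erase_of_card_ne T hP q

theorem sum_minor_erase_of_notMem (T : Mode n → Mode n → ℂ) (P : Finset (Mode n))
    {Q : Finset (Mode n)} {q : Mode n} (hq : q ∉ Q) :
    ∑ p ∈ P, finsetSign p P * T p q * minor T (P.erase p) Q =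
      finsetSign q Q * minor T P (insert q Q) := by
  have hins : (insert q Q).card = Q.card + 1 := Finset.card_insert_of_notMem hq
  by_cases hP : P.card = Q.card + 1
  · set e := (insert q Q).orderEmbOfFin hins
    obtain ⟨j, hj⟩ : q ∈ Set.range e := by simp [e]
    have he : (Q.orderEmbOfFin rfl : Fin Q.card → Mode n) = j.removeNth e := by
      refine (Finset.orderEmbOfFin_unique rfl (fun a => ?_)
        (e.strictMono.comp (Fin.strictMono_succAbove j))).symm
      refine (Finset.mem_insert.1 (Finset.orderEmbOfFin_mem _ hins _)).resolve_left fun h => ?_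
      exact Fin.succAbove_ne j a (e.injective (h.trans hj.symm))
    have hsign : finsetSign q Q = (-1) ^ (j : ℕ) := by
      rw [← finsetSign_orderEmbOfFin _ hins, hj, finsetSign, finsetSign, Finset.filter_insert,
        if_neg (lt_irrefl q)]
    rw [sum_minor_erase_eq_det_insertNth T hP rfl q j, he, ← hj, Fin.insertNth_self_removeNth, hj,
      hsign, minor_eq_det (P.orderEmbOfFin hP).strictMono e.strictMono hP hins
      (P.orderEmbOfFin_mem hP) (Finset.orderEmbOfFin_mem _ hins)]
  · rw [sum_minor_erase_of_card_ne T hP, minor_of_card_ne (by rwa [hins]), mul_zero]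

theorem strictMono_append {α : Type*} [Preorder α] {k m : ℕ} {f : Fin k → α} {g : Fin m → α}
    (hf : StrictMono f) (hg : StrictMono g) (hfg : ∀ a b, f a < g b) :
    StrictMono (Fin.append f g) := by
  intro a b
  refine Fin.addCases (fun a => ?_) (fun a => ?_) a <;>
    refine Fin.addCases (fun b => ?_) (fun b => ?_) b <;> intro h
  · simp only [Fin.append_left]
    exact hf h
  · simpa using hfg a b
  · exfalso
    simp only [Fin.lt_def, Fin.val_natAdd, Fin.val_castAdd] at h
    omega
  · simp only [Fin.append_right]
    simp only [Fin.lt_def, Fin.val_natAdd] at h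
    exact hg (by omega)

theorem minor_union {T : Mode n → Mode n → ℂ} {P Q L : Finset (Mode n)}
    (hP : ∀ p ∈ P, ∀ q ∈ L, p < q) (hQ : ∀ p ∈ Q, ∀ q ∈ L, p < q)
    (hT : ∀ p ∈ P, ∀ q ∈ L, T p q = 0) :
    minor T (P ∪ L) (Q ∪ L) = minor T P Q * minor T L L := by
  have hPL : (P ∪ L).card = P.card + L.card := Finset.card_union_of_disjoint
    (Finset.disjoint_left.2 fun p hp hq => lt_irrefl _ (hP p hp p hq))
  have hQL : (Q ∪ L).card = Q.card + L.card := Finset.card_union_of_disjoint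
    (Finset.disjoint_left.2 fun p hp hq => lt_irrefl _ (hQ p hp p hq))
  by_cases h : P.card = Q.card
  · rw [h] at hPL
    have mP := P.orderEmbOfFin_mem h
    have mQ := Q.orderEmbOfFin_mem rfl
    have mL := L.orderEmbOfFin_mem rfl
    rw [minor_eq_det (P.orderEmbOfFin h).strictMono (Q.orderEmbOfFin rfl).strictMono h rfl mP mQ,
      minor_eq_det (L.orderEmbOfFin rfl).strictMono (L.orderEmbOfFin rfl).strictMono rfl rfl mL mL,
      minor_eq_det
        (strictMono_append (P.orderEmbOfFin h).strictMono (L.orderEmbOfFin rfl).strictMono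
          fun a b => hP _ (mP a) _ (mL b))
        (strictMono_append (Q.orderEmbOfFin rfl).strictMono (L.orderEmbOfFin rfl).strictMono
          fun a b => hQ _ (mQ a) _ (mL b)) hPL hQL,
      ← Matrix.det_submatrix_equiv_self finSumFinEquiv]
    · rw [← Matrix.det_fromBlocks_zero₁₂ _ (Matrix.of fun a b =>
        T (L.orderEmbOfFin rfl a) (Q.orderEmbOfFin rfl b))]
      congr 1
      ext (a | a) (b | b) <;> simp [hT _ (mP _) _ (mL _)]
    · intro a
      refine Fin.addCases (fun a => ?_) (fun a => ?_) a
      · simp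
      · simp
    · intro a
      refine Fin.addCases (fun a => ?_) (fun a => ?_) a
      · simp
      · simp
  · rw [minor_of_card_ne h, minor_of_card_ne (by omega), zero_mul]

/-- The basis vectors `e_i z^N`. -/
def level (n : ℕ) (N : ℤ) : Finset (Mode n) :=
  Finset.univ.map ⟨fun i : Fin n => mode i N, fun _ _ h => (mode_inj.1 h).1⟩

theorem mem_level {N : ℤ} {p : Mode n} : p ∈ level n N ↔ deg p = N := by
  simp only [level, Finset.mem_map, Finset.mem_univ, true_and]
  constructor
  · rintro ⟨i, rfl⟩
    rfl
  · rintro rfl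
    exact ⟨idx p, mode_idx_deg p⟩

theorem minor_level (T : Mode n → Mode n → ℂ) (N : ℤ) :
    minor T (level n N) (level n N) =
      Matrix.det (Matrix.of fun i j => T (mode i N) (mode j N)) := by
  have hm : StrictMono fun i : Fin n => mode i N := fun i j h =>
    Prod.Lex.lt_iff.2 (Or.inr ⟨rfl, h⟩)
  have hc : (level n N).card = n := by simp [level]
  exact minor_eq_det hm hm hc hc (fun _ => mem_level.2 rfl) (fun _ => mem_level.2 rfl)

/-- The basis vectors `e_i z^d` with `-N ≤ d < N`. -/
def window (n N : ℕ) : Finset (Mode n) :=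
  (Finset.Ico (-(N : ℤ)) N ×ˢ (Finset.univ : Finset (Fin n))).map toLex.toEmbedding

theorem mem_window {N : ℕ} {p : Mode n} : p ∈ window n N ↔ -(N : ℤ) ≤ deg p ∧ deg p < N := by
  simp only [window, Finset.mem_map, Finset.mem_product, Finset.mem_Ico, Finset.mem_univ, and_true]
  constructor
  · rintro ⟨x, hx, rfl⟩
    exact hx
  · intro h
    exact ⟨ofLex p, h, rfl⟩

namespace Maya

/-- The wedge product `v` differs from the vacuum vector only in factors `e_i z^d` with
`-N ≤ d < N`. -/
def AgreesOutside (v : Maya n) (N : ℕ) : Prop :=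
  (∀ p ∈ v.carrier, -(N : ℤ) ≤ deg p) ∧ ∀ p, (N : ℤ) ≤ deg p → p ∈ v.carrier

theorem eventually_agreesOutside (v : Maya n) : ∀ᶠ N in atTop, v.AgreesOutside N := by
  obtain ⟨a, ha⟩ := v.bounded_below
  obtain ⟨b, hb⟩ := v.tail
  filter_upwards [eventually_ge_atTop (-a).toNat, eventually_ge_atTop b.toNat] with N hNa hNb
  refine ⟨fun p hp => ?_, fun p hp => hb p (by lia)⟩
  have := ha p hp
  lia

theorem agreesOutside_vacuum (N : ℕ) : (vacuum : Maya n).AgreesOutside N :=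
  ⟨fun p hp => by rw [mem_vacuum] at hp; lia, fun p hp => mem_vacuum.2 (by lia)⟩

theorem mem_below {v : Maya n} {N : ℕ} {p : Mode n} :
    p ∈ v.below N ↔ p ∈ v.carrier ∧ deg p < N := by
  simp [below]

theorem AgreesOutside.below_subset_window {v : Maya n} {N : ℕ} (h : v.AgreesOutside N) :
    v.below N ⊆ window n N := fun p hp =>
  mem_window.2 ⟨h.1 p (mem_below.1 hp).1, (mem_below.1 hp).2⟩

theorem below_succ {v : Maya n} {N : ℕ} (h : v.AgreesOutside N) :
    v.below (N + 1) = v.below N ∪ level n N := by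
  ext p
  have := h.2 p
  simp only [mem_below, Finset.mem_union, mem_level]
  grind

theorem below_insert {v : Maya n} {N : ℕ} {p : Mode n} (hp : deg p < N) :
    (v.insert p).below N = Insert.insert p (v.below N) := by
  ext q
  simp only [mem_below, Finset.mem_insert, mem_insert]
  grind

theorem below_erase (v : Maya n) (N : ℕ) (p : Mode n) :
    (v.erase p).below N = (v.below N).erase p := by
  ext q
  simp only [mem_below, Finset.mem_erase, mem_erase]
  grind

theorem finsetSign_below (v : Maya n) {N : ℕ} {p : Mode n} (hp : deg p < N) :
    finsetSign p (v.below N) = v.sign p := by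
  rw [finsetSign, sign, ← Set.ncard_coe_finset]
  congr 2
  ext q
  simp only [Finset.coe_filter, mem_below, Set.mem_ofPred_eq]
  exact ⟨fun h => ⟨h.1.1, h.2⟩, fun h => ⟨⟨h.1, (deg_le_of_le h.2.le).trans_lt hp⟩, h.2⟩⟩

end Maya

theorem contract_single_eq_zero {v : Maya n} {N : ℕ} (h : v.AgreesOutside N) {p : Mode n}
    (hp : deg p < -N) (c : ℂ) : contract p (Finsupp.single v c) = 0 := by
  rw [contract_single, if_neg fun hv => (h.1 p hv).not_gt hp]

theorem wedge_single_eq_zero {v : Maya n} {N : ℕ} (h : v.AgreesOutside N) {p : Mode n}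
    (hp : N ≤ deg p) (c : ℂ) : wedge p (Finsupp.single v c) = 0 := by
  rw [wedge_single, if_pos (h.2 p hp)]

/-- The operator of `T` with matrix elements truncated to powers of `z` below `N`. The action
`groupOp T` is the limit of these operators. -/
def truncation (T : Mode n → Mode n → ℂ) (N : ℕ) : Op n := fun w v =>
  minor T (w.below N) (v.below N) /
    minor T ((vacuum : Maya n).below N) ((vacuum : Maya n).below N)

theorem truncation_flip (T : Mode n → Mode n → ℂ) (N : ℕ) :
    truncation (flip T) N = flip (truncation T N) := by
  ext w v
  simp only [truncation, minor_flip, flip]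

/-- Expansion along the column `q`. -/
theorem matrixForm_truncation_wedge_right (T : Mode n → Mode n → ℂ) {N : ℕ} {w : Maya n}
    (hw : w.AgreesOutside N) (v : Maya n) {q : Mode n} (hq : deg q < N) :
    matrixForm (truncation T N) (Finsupp.single w 1) (wedge q (Finsupp.single v 1)) =
      ∑ p ∈ window n N, T p q *
        matrixForm (truncation T N) (contract p (Finsupp.single w 1)) (Finsupp.single v 1) := by
  rw [← Finset.sum_subset hw.below_subset_window]
  · have hsum : ∀ p ∈ w.below N, T p q * matrixForm (truncation T N)
        (contract p (Finsupp.single w 1)) (Finsupp.single v 1) =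
          finsetSign p (w.below N) * T p q * minor T ((w.below N).erase p) (v.below N) /
            minor T ((vacuum : Maya n).below N) ((vacuum : Maya n).below N) := fun p hp => by
      rw [contract_single, if_pos (mem_below.1 hp).1, matrixForm_single, truncation, below_erase,
        finsetSign_below w (mem_below.1 hp).2]
      ring
    rw [Finset.sum_congr rfl hsum, ← Finset.sum_div, wedge_single]
    split_ifs with hv
    · rw [sum_minor_erase_of_mem T _ (mem_below.2 ⟨hv, hq⟩)]
      simp
    · rw [sum_minor_erase_of_notMem T _ fun h => hv (mem_below.1 h).1, matrixForm_single,
        truncation, below_insert hq, finsetSign_below v hq]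
      ring
  · intro p hp hpw
    rw [contract_single, if_neg fun h => hpw (mem_below.2 ⟨h, (mem_window.1 hp).2⟩)]
    simp

/-- Expansion along the row `p`. -/
theorem matrixForm_truncation_wedge_left (T : Mode n → Mode n → ℂ) {N : ℕ} (w : Maya n)
    {v : Maya n} (hv : v.AgreesOutside N) {p : Mode n} (hp : deg p < N) :
    matrixForm (truncation T N) (wedge p (Finsupp.single w 1)) (Finsupp.single v 1) =
      ∑ q ∈ window n N, T p q *
        matrixForm (truncation T N) (Finsupp.single w 1) (contract q (Finsupp.single v 1)) := by
  have h := matrixForm_truncation_wedge_right (flip T) hv w hp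
  rw [truncation_flip, ← matrixForm_flip] at h
  exact h

/-- The truncations of the operator of `T` stabilize. -/
def IsStable (T : Mode n → Mode n → ℂ) : Prop :=
  ∀ w v : Maya n, ∃ c, ∀ᶠ N in atTop, truncation T N w v = c

theorem IsStable.eventually_eq {T : Mode n → Mode n → ℂ} (hT : IsStable T) (w v : Maya n) :
    ∀ᶠ N in atTop, truncation T N w v = groupOp T w v := by
  have h := hT w v
  change ∀ᶠ N in atTop, truncation T N w v = eventualValue fun N => truncation T N w v
  rw [eventualValue, dif_pos h]
  exact h.choose_spec

theorem IsStable.flip {T : Mode n → Mode n → ℂ} (hT : IsStable T) : IsStable (flip T) := by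
  intro w v
  simp only [truncation_flip]
  exact hT v w

theorem minor_below_succ {T : Mode n → Mode n → ℂ} (hT : ∀ p q, deg p < deg q → T p q = 0)
    {w v : Maya n} {N : ℕ} (hw : w.AgreesOutside N) (hv : v.AgreesOutside N) :
    minor T (w.below (N + 1)) (v.below (N + 1)) = minor T (w.below N) (v.below N) *
      Matrix.det (Matrix.of fun i j => T (mode i N) (mode j N)) := by
  have hlt (v : Maya n) : ∀ p ∈ v.below N, ∀ q ∈ level n (N : ℤ), deg p < deg q :=
    fun p hp q hq => mem_level.1 hq ▸ (mem_below.1 hp).2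
  rw [below_succ hw, below_succ hv,
    minor_union (fun p hp q hq => lt_of_deg_lt (hlt w p hp q hq))
      (fun p hp q hq => lt_of_deg_lt (hlt v p hp q hq))
      (fun p hp q hq => hT _ _ (hlt w p hp q hq)), minor_level]

theorem isStable_of_blockTriangular {T : Mode n → Mode n → ℂ}
    (hT : ∀ p q, deg p < deg q → T p q = 0)
    (hdet : ∀ N : ℕ, Matrix.det (Matrix.of fun i j => T (mode i N) (mode j N)) ≠ 0) :
    IsStable T := by
  intro w v
  obtain ⟨N₀, hN₀⟩ := eventually_atTop.1 (w.eventually_agreesOutside.and v.eventually_agreesOutside)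
  refine ⟨truncation T N₀ w v, eventually_atTop.2 ⟨N₀, fun N hN => ?_⟩⟩
  induction N, hN using Nat.le_induction with
  | base => rfl
  | succ N hN ih =>
    rw [truncation, minor_below_succ hT (hN₀ N hN).1 (hN₀ N hN).2,
      minor_below_succ hT (agreesOutside_vacuum N) (agreesOutside_vacuum N),
      mul_div_mul_right _ _ (hdet N), ← ih, truncation]

section PairOp

variable {R ι V : Type*} [CommSemiring R] [AddCommMonoid V] [Module R V]

/-- Local finiteness of the sum `∑ p, X p ⊗ Y p`. -/
def IsLocallyFinite (X Y : ι → Module.End R V) : Prop :=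
  ∀ f g, (Function.support fun p => X p f ⊗ₜ[R] Y p g).Finite

/-- The operator `∑ p, X p ⊗ Y p`. -/
def pairOp (X Y : ι → Module.End R V) (h : IsLocallyFinite X Y) : Module.End R (V ⊗[R] V) :=
  TensorProduct.lift <| LinearMap.mk₂ R (fun f g => ∑ᶠ p, X p f ⊗ₜ[R] Y p g)
    (fun f f' g => by
      simp only [map_add, TensorProduct.add_tmul]
      exact finsum_add_distrib (h f g) (h f' g))
    (fun c f g => by
      simp only [map_smul, ← TensorProduct.smul_tmul']
      exact (smul_finsum' c (h f g)).symm)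
    (fun f g g' => by
      simp only [map_add, TensorProduct.tmul_add]
      exact finsum_add_distrib (h f g) (h f g'))
    (fun c f g => by
      simp only [map_smul, TensorProduct.tmul_smul]
      exact (smul_finsum' c (h f g)).symm)

variable {X Y Xt Yt : ι → Module.End R V}

theorem pairOp_tmul (h : IsLocallyFinite X Y) (f g : V) :
    pairOp X Y h (f ⊗ₜ g) = ∑ᶠ p, X p f ⊗ₜ[R] Y p g := rfl

theorem tmul_pairOp_right (B : BilinForm R V) (h : IsLocallyFinite X Y) (a a' f g : V) :
    B.tmul B (a ⊗ₜ a') (pairOp X Y h (f ⊗ₜ g)) = ∑ᶠ p, B a (X p f) * B a' (Y p g) := by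
  rw [pairOp_tmul, map_finsum _ (h f g)]
  simp only [tmul_apply_tmul]

theorem tmul_pairOp_left (B : BilinForm R V) (h : IsLocallyFinite X Y) (a a' f g : V) :
    B.tmul B (pairOp X Y h (a ⊗ₜ a')) (f ⊗ₜ g) = ∑ᶠ p, B (X p a) f * B (Y p a') g := by
  have hflip := tmul_pairOp_right (LinearMap.flip B) h f g a a'
  rw [← tmul_flip] at hflip
  exact hflip

theorem intertwines_pairOp_of_isAdjointPair {B : BilinForm R V} (ht : IsLocallyFinite Xt Yt)
    (h : IsLocallyFinite X Y) (hX : ∀ p, IsAdjointPair B B (Xt p) (X p))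
    (hY : ∀ p, IsAdjointPair B B (Yt p) (Y p)) :
    Intertwines (pairOp Xt Yt ht) (pairOp X Y h) B := by
  rw [Intertwines, LinearMap.isAdjointPair_iff_comp_eq_compl₂]
  ext a a' f g
  simp [tmul_pairOp_left, tmul_pairOp_right, hX _ _ _, hY _ _ _]

end PairOp

section Limit

variable {R ι κ : Type*} [CommSemiring R] {l : Filter κ} {M : κ → ι → ι → R} {M' : ι → ι → R}

theorem eventually_matrixForm_eq (h : ∀ i j, ∀ᶠ N in l, M N i j = M' i j) (a b : ι →₀ R) :
    ∀ᶠ N in l, matrixForm (M N) a b = matrixForm M' a b := by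
  have hall : ∀ᶠ N in l, ∀ i ∈ a.support, ∀ j ∈ b.support, M N i j = M' i j := by
    simp only [eventually_all_finset]
    exact fun i _ j _ => h i j
  filter_upwards [hall] with N hN
  simp only [matrixForm_apply]
  exact Finsupp.sum_congr fun i hi =>
    congrArg _ (Finsupp.sum_congr fun j hj => by rw [hN i hi j hj])

theorem eventually_tmul_matrixForm_eq (h : ∀ i j, ∀ᶠ N in l, M N i j = M' i j)
    (s t : (ι →₀ R) ⊗[R] (ι →₀ R)) :
    ∀ᶠ N in l, BilinForm.tmul (matrixForm (M N)) (matrixForm (M N)) s t =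
      BilinForm.tmul (matrixForm M') (matrixForm M') s t := by
  induction s using TensorProduct.induction_on with
  | zero => simp
  | add s s' hs hs' => filter_upwards [hs, hs'] with N h₁ h₂; simp [h₁, h₂]
  | tmul a a' =>
    induction t using TensorProduct.induction_on with
    | zero => simp
    | add t t' ht ht' => filter_upwards [ht, ht'] with N h₁ h₂; simp only [map_add, h₁, h₂]
    | tmul b b' =>
      filter_upwards [eventually_matrixForm_eq h a b, eventually_matrixForm_eq h a' b']
        with N h₁ h₂
      rw [tmul_apply_tmul, tmul_apply_tmul, h₁, h₂]

theorem intertwines_of_eventually [l.NeBot] (h : ∀ i j, ∀ᶠ N in l, M N i j = M' i j)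
    {Ωt Ω : Module.End R ((ι →₀ R) ⊗[R] (ι →₀ R))}
    (hΩ : ∀ i i' j j', ∀ᶠ N in l, BilinForm.tmul (matrixForm (M N)) (matrixForm (M N))
        (Ωt (Finsupp.single i 1 ⊗ₜ Finsupp.single i' 1))
          (Finsupp.single j 1 ⊗ₜ Finsupp.single j' 1) =
      BilinForm.tmul (matrixForm (M N)) (matrixForm (M N))
        (Finsupp.single i 1 ⊗ₜ Finsupp.single i' 1)
          (Ω (Finsupp.single j 1 ⊗ₜ Finsupp.single j' 1))) :
    Intertwines Ωt Ω (matrixForm M') := by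
  rw [Intertwines, LinearMap.isAdjointPair_iff_comp_eq_compl₂]
  ext i i' j j'
  obtain ⟨N, h₁, h₂, h₃⟩ := ((hΩ i i' j j').and ((eventually_tmul_matrixForm_eq h _ _).and
    (eventually_tmul_matrixForm_eq h _ _))).exists
  exact h₂.symm.trans (h₁.trans h₃)

end Limit

/-- The dual basis vector `e_i z^(-1-d)` of `e_i z^d` with respect to the symplectic form. -/
def dualMode (p : Mode n) : Mode n := mode (idx p) (-1 - deg p)

/-- The coefficient `(-1)^d` of the symplectic form. -/
def modeParity (p : Mode n) : ℂ := (-1) ^ deg p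

theorem deg_dualMode (p : Mode n) : deg (dualMode p) = -1 - deg p := rfl

theorem dualMode_dualMode (p : Mode n) : dualMode (dualMode p) = p := by
  unfold dualMode
  rw [deg_mode, idx_mode, sub_sub_cancel]
  rfl

theorem dualMode_mem_window {N : ℕ} {p : Mode n} : dualMode p ∈ window n N ↔ p ∈ window n N := by
  simp only [mem_window, deg_dualMode]
  grind

theorem isLocallyFinite_wedge_contract : IsLocallyFinite (wedge (n := n)) contract := by
  intro f g
  obtain ⟨b, hb⟩ := exists_wedge_eq_zero f
  obtain ⟨a, ha⟩ := exists_contract_eq_zero g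
  refine (finite_deg_mem_Icc a b).subset fun p hp => ⟨?_, ?_⟩ <;> by_contra! h <;> apply hp
  · simp [ha p h]
  · simp [hb p h.le]

theorem isLocallyFinite_contract_wedge : IsLocallyFinite (contract (n := n)) wedge := by
  intro f g
  obtain ⟨b, hb⟩ := exists_wedge_eq_zero g
  obtain ⟨a, ha⟩ := exists_contract_eq_zero f
  refine (finite_deg_mem_Icc a b).subset fun p hp => ⟨?_, ?_⟩ <;> by_contra! h <;> apply hp
  · simp [ha p h]
  · simp [hb p h.le]

theorem isLocallyFinite_wedge_dual :
    IsLocallyFinite (wedge (n := n)) fun p => modeParity p • wedge (dualMode p) := by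
  intro f g
  obtain ⟨b, hb⟩ := exists_wedge_eq_zero f
  obtain ⟨b', hb'⟩ := exists_wedge_eq_zero g
  refine (finite_deg_mem_Icc (-1 - b') b).subset fun p hp => ⟨?_, ?_⟩ <;> by_contra! h <;> apply hp
  · simp [hb' (dualMode p) (by rw [deg_dualMode]; lia)]
  · simp [hb p h.le]

theorem isLocallyFinite_contract_dual :
    IsLocallyFinite (contract (n := n)) fun p => modeParity p • contract (dualMode p) := by
  intro f g
  obtain ⟨b, hb⟩ := exists_contract_eq_zero f
  obtain ⟨b', hb'⟩ := exists_contract_eq_zero g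
  refine (finite_deg_mem_Icc b (-1 - b')).subset fun p hp => ⟨?_, ?_⟩ <;> by_contra! h <;> apply hp
  · simp [hb p h]
  · simp [hb' (dualMode p) (by rw [deg_dualMode]; lia)]

/-- The operator `∑ p, p ∧ ⊗ ∂_p`, which commutes with the action of every matrix. -/
def bilinearOp : Module.End ℂ (Fock n ⊗[ℂ] Fock n) :=
  pairOp wedge contract isLocallyFinite_wedge_contract

/-- The operator `∑ p, ∂_p ⊗ p ∧`, the transpose of `bilinearOp`. -/
def bilinearOpT : Module.End ℂ (Fock n ⊗[ℂ] Fock n) :=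
  pairOp contract wedge isLocallyFinite_contract_wedge

/-- The operator `∑ p, ± p ∧ ⊗ p* ∧`, which commutes with the action of symplectic matrices. -/
def symplecticOp : Module.End ℂ (Fock n ⊗[ℂ] Fock n) :=
  pairOp wedge (fun p => modeParity p • wedge (dualMode p)) isLocallyFinite_wedge_dual

/-- The operator `∑ p, ± ∂_p ⊗ ∂_{p*}`, the transpose of `symplecticOp`. -/
def symplecticOpT : Module.End ℂ (Fock n ⊗[ℂ] Fock n) :=
  pairOp contract (fun p => modeParity p • contract (dualMode p)) isLocallyFinite_contract_dual

theorem isAdjointPair_contract_wedge (p : Mode n) :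
    IsAdjointPair dotForm dotForm (contract p) (wedge p) := fun a b => by
  rw [dotForm_comm, ← isAdjointPair_wedge_contract p b a, dotForm_comm]

theorem intertwines_bilinearOp_dotForm : Intertwines (bilinearOpT (n := n)) bilinearOp dotForm :=
  intertwines_pairOp_of_isAdjointPair _ _ isAdjointPair_contract_wedge isAdjointPair_wedge_contract

theorem intertwines_symplecticOp_dotForm :
    Intertwines (symplecticOpT (n := n)) symplecticOp dotForm :=
  intertwines_pairOp_of_isAdjointPair _ _ isAdjointPair_contract_wedge fun p =>
    (isAdjointPair_contract_wedge (dualMode p)).smul (modeParity p)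

theorem intertwines_bilinearOp_groupOp {T : Mode n → Mode n → ℂ} (hT : IsStable T) :
    Intertwines bilinearOpT bilinearOp (matrixForm (groupOp T)) := by
  refine intertwines_of_eventually hT.eventually_eq fun w w' v v' => ?_
  filter_upwards [w.eventually_agreesOutside, w'.eventually_agreesOutside,
    v.eventually_agreesOutside, v'.eventually_agreesOutside] with N hw hw' hv hv'
  rw [bilinearOpT, bilinearOp, tmul_pairOp_left, tmul_pairOp_right,
    finsum_eq_sum_of_support_subset (s := window n N), finsum_eq_sum_of_support_subset
      (s := window n N)]
  · rw [Finset.sum_congr rfl fun p hp => by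
      rw [matrixForm_truncation_wedge_left T w' hv' (mem_window.1 hp).2, Finset.mul_sum],
      Finset.sum_comm]
    refine Finset.sum_congr rfl fun q hq => ?_
    rw [matrixForm_truncation_wedge_right T hw v (mem_window.1 hq).2, Finset.sum_mul]
    exact Finset.sum_congr rfl fun p _ => by ring
  · refine fun p hp => mem_window.2 ⟨?_, ?_⟩ <;> by_contra! h <;> apply hp
    · simp [contract_single_eq_zero hv' h]
    · simp [wedge_single_eq_zero hv h]
  · refine fun p hp => mem_window.2 ⟨?_, ?_⟩ <;> by_contra! h <;> apply hp
    · simp [contract_single_eq_zero hw h]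
    · simp [wedge_single_eq_zero hw' h]

/-- The matrix `T`, truncated to a window, preserves the symplectic form. -/
def IsFormPreserving (T : Mode n → Mode n → ℂ) : Prop :=
  ∀ (N : ℕ), ∀ r ∈ window n N, ∀ r' ∈ window n N,
    ∑ p ∈ window n N, modeParity p * (T r p * T r' (dualMode p)) =
      if r' = dualMode r then modeParity r else 0

theorem IsFormPreserving.sum_mul_sum {T : Mode n → Mode n → ℂ} (hT : IsFormPreserving T) (N : ℕ)
    (f f' : Mode n → ℂ) :
    ∑ p ∈ window n N, modeParity p * ((∑ r ∈ window n N, T r p * f r) *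
        ∑ r' ∈ window n N, T r' (dualMode p) * f' r') =
      ∑ r ∈ window n N, modeParity r * (f r * f' (dualMode r)) := by
  calc _ = ∑ p ∈ window n N, ∑ r ∈ window n N, ∑ r' ∈ window n N,
          f r * f' r' * (modeParity p * (T r p * T r' (dualMode p))) := by
        refine Finset.sum_congr rfl fun p _ => ?_
        rw [Finset.sum_mul_sum, Finset.mul_sum]
        simp only [Finset.mul_sum]
        exact Finset.sum_congr rfl fun r _ => Finset.sum_congr rfl fun r' _ => by ring
    _ = ∑ r ∈ window n N, ∑ r' ∈ window n N, ∑ p ∈ window n N,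
          f r * f' r' * (modeParity p * (T r p * T r' (dualMode p))) := by
        rw [Finset.sum_comm, Finset.sum_congr rfl fun r _ => Finset.sum_comm]
    _ = ∑ r ∈ window n N, ∑ r' ∈ window n N,
          f r * f' r' * if r' = dualMode r then modeParity r else 0 :=
        Finset.sum_congr rfl fun r hr => Finset.sum_congr rfl fun r' hr' => by
          rw [← hT N r hr r' hr', Finset.mul_sum]
    _ = _ := Finset.sum_congr rfl fun r hr => by simp [dualMode_mem_window.2 hr, mul_comm]

theorem intertwines_symplecticOp_groupOp {T : Mode n → Mode n → ℂ} (hT : IsStable T)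
    (hform : IsFormPreserving T) :
    Intertwines symplecticOpT symplecticOp (matrixForm (groupOp T)) := by
  refine intertwines_of_eventually hT.eventually_eq fun w w' v v' => ?_
  filter_upwards [w.eventually_agreesOutside, w'.eventually_agreesOutside,
    v.eventually_agreesOutside, v'.eventually_agreesOutside] with N hw hw' hv hv'
  rw [symplecticOpT, symplecticOp, tmul_pairOp_left, tmul_pairOp_right,
    finsum_eq_sum_of_support_subset (s := window n N), finsum_eq_sum_of_support_subset
      (s := window n N)]
  · simp only [LinearMap.smul_apply, map_smul, smul_eq_mul, mul_left_comm _ (modeParity _)]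
    rw [← hform.sum_mul_sum N
      (fun r => matrixForm (truncation T N) (contract r (Finsupp.single w 1)) (Finsupp.single v 1))
      fun r => matrixForm (truncation T N) (contract r (Finsupp.single w' 1)) (Finsupp.single v' 1)]
    exact Finset.sum_congr rfl fun p hp => by
      rw [matrixForm_truncation_wedge_right T hw v (mem_window.1 hp).2,
        matrixForm_truncation_wedge_right T hw' v' (mem_window.1 (dualMode_mem_window.2 hp)).2]
  · refine fun p hp => mem_window.2 ⟨?_, ?_⟩ <;> by_contra! h <;> apply hp
    · simp [wedge_single_eq_zero hv' (p := dualMode p) (by rw [deg_dualMode]; lia)]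
    · simp [wedge_single_eq_zero hv h]
  · refine fun p hp => mem_window.2 ⟨?_, ?_⟩ <;> by_contra! h <;> apply hp
    · simp [contract_single_eq_zero hw h]
    · simp [contract_single_eq_zero hw' (p := dualMode p) (by rw [deg_dualMode]; lia)]

namespace IsSymplecticSeries

variable {B : ℕ → Matrix (Fin n) (Fin n) ℂ}

theorem det_ne_zero (hB : IsSymplecticSeries B) : (B 0).det ≠ 0 := by
  have h := congrArg Matrix.det (hB 0)
  simp only [Finset.HasAntidiagonal.antidiagonal_zero, Finset.sum_singleton, pow_zero, one_smul,
    Matrix.det_mul, if_true, Matrix.det_one] at h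
  exact right_ne_zero_of_mul (h ▸ one_ne_zero)

theorem sum_antidiagonal_mul_transpose (hB : IsSymplecticSeries B) (m : ℕ) :
    ∑ x ∈ Finset.HasAntidiagonal.antidiagonal m, (-1 : ℂ) ^ x.2 • (B x.1 * (B x.2).transpose) =
      if m = 0 then 1 else 0 := by
  let X : PowerSeries (Matrix (Fin n) (Fin n) ℂ) :=
    PowerSeries.mk fun k => (-1 : ℂ) ^ k • (B k).transpose
  let Y : PowerSeries (Matrix (Fin n) (Fin n) ℂ) := PowerSeries.mk B
  have hXY : X * Y = 1 := by
    ext1 k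
    simp only [X, Y, PowerSeries.coeff_mul, PowerSeries.coeff_mk, Matrix.smul_mul,
      PowerSeries.coeff_one]
    exact hB k
  obtain ⟨u, hu⟩ := (Matrix.isUnit_iff_isUnit_det (B 0)).2 hB.det_ne_zero.isUnit
  have hY : Y * Y.invOfUnit u = 1 :=
    PowerSeries.mul_invOfUnit Y u (by simp [Y, hu])
  have hYX : Y * X = 1 := left_inv_eq_right_inv hXY hY ▸ hY
  have h := congrArg (PowerSeries.coeff m) hYX
  simpa only [X, Y, PowerSeries.coeff_mul, PowerSeries.coeff_mk, Matrix.mul_smul,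
    PowerSeries.coeff_one] using h

end IsSymplecticSeries

section Entries

variable (B : ℕ → Matrix (Fin n) (Fin n) ℂ)

theorem plusEntry_of_eq {p q : Mode n} {k : ℕ} (h : deg p = deg q + k) :
    plusEntry B p q = B k (idx p) (idx q) := by
  rw [plusEntry, if_pos (by lia), h, add_sub_cancel_left, Int.toNat_natCast]

theorem plusEntry_of_lt {p q : Mode n} (h : deg p < deg q) : plusEntry B p q = 0 :=
  if_neg h.not_ge

theorem plusEntry_dualMode (p q : Mode n) :
    plusEntry B (dualMode p) (dualMode q) = minusEntry B p q := by
  unfold plusEntry minusEntry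
  rw [deg_dualMode, deg_dualMode, sub_sub_sub_cancel_left]
  exact if_congr (sub_le_sub_iff_left _) rfl rfl

end Entries

theorem modeParity_dualMode (p : Mode n) : modeParity (dualMode p) = -modeParity p := by
  rw [modeParity, modeParity, deg_dualMode, zpow_sub₀ (by norm_num), div_eq_mul_inv, ← inv_zpow]
  norm_num

theorem eq_dualMode_iff {r r' : Mode n} :
    r' = dualMode r ↔ deg r + deg r' + 1 = 0 ∧ idx r = idx r' := by
  rw [dualMode, ← mode_idx_deg r', mode_inj, idx_mode, deg_mode, and_comm, eq_comm (a := idx r)]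
  exact and_congr_left' (by lia)

theorem sum_plusEntry_mul_plusEntry {B : ℕ → Matrix (Fin n) (Fin n) ℂ} {N m : ℕ} {r r' : Mode n}
    (hr : r ∈ window n N) (hr' : r' ∈ window n N) (hm : deg r + deg r' + 1 = m) :
    ∑ p ∈ window n N, modeParity p * (plusEntry B r p * plusEntry B r' (dualMode p)) =
      -modeParity r' * (∑ x ∈ Finset.HasAntidiagonal.antidiagonal m,
        (-1 : ℂ) ^ x.2 • (B x.1 * (B x.2).transpose)) (idx r) (idx r') := by
  rw [mem_window] at hr hr'
  symm
  simp only [Matrix.sum_apply, Matrix.smul_apply, Matrix.mul_apply, Matrix.transpose_apply,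
    smul_eq_mul, Finset.mul_sum]
  rw [← Finset.sum_product']
  refine Finset.sum_of_injOn (fun x => mode x.2 (deg r - x.1.1)) ?_ ?_ ?_ ?_
  · rintro ⟨⟨k, k'⟩, i⟩ hx ⟨⟨l, l'⟩, j⟩ hy h
    simp only [Finset.coe_product, Set.mem_prod, Finset.mem_coe,
      Finset.HasAntidiagonal.mem_antidiagonal, mode_inj] at hx hy h
    grind
  · rintro ⟨⟨k, k'⟩, i⟩ hx
    simp only [Finset.coe_product, Set.mem_prod, Finset.mem_coe,
      Finset.HasAntidiagonal.mem_antidiagonal, mem_window, deg_mode] at hx ⊢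
    lia
  · intro p _ hp
    by_cases h₁ : deg p ≤ deg r
    · by_cases h₂ : deg (dualMode p) ≤ deg r'
      · refine absurd ⟨(((deg r - deg p).toNat, (deg r' - deg (dualMode p)).toNat), idx p), ?_, ?_⟩
          hp
        · simp only [Finset.coe_product, Set.mem_prod, Finset.mem_coe,
            Finset.HasAntidiagonal.mem_antidiagonal, deg_dualMode] at h₂ ⊢
          exact ⟨by lia, Finset.mem_univ _⟩
        · simp [h₁, mode_idx_deg]
      · rw [plusEntry_of_lt (p := r') B (not_le.1 h₂), mul_zero, mul_zero]
    · rw [plusEntry_of_lt B (not_le.1 h₁), zero_mul, mul_zero]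
  · rintro ⟨⟨k, k'⟩, i⟩ hx
    have hk : k + k' = m := by simpa using hx
    have hd : deg r - k = deg (dualMode r') + k' := by rw [deg_dualMode]; lia
    rw [plusEntry_of_eq B (k := k) (by rw [deg_mode]; lia),
      plusEntry_of_eq B (k := k') (by rw [deg_dualMode, deg_mode]; lia), ← modeParity_dualMode,
      modeParity, modeParity, deg_mode, hd, zpow_add₀ (by norm_num), zpow_natCast, mul_assoc]
    rfl

theorem isFormPreserving_plusEntry {B : ℕ → Matrix (Fin n) (Fin n) ℂ}
    (hB : IsSymplecticSeries B) : IsFormPreserving (plusEntry B) := by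
  intro N r hr r' hr'
  by_cases hm : 0 ≤ deg r + deg r' + 1
  · obtain ⟨m, hm⟩ := Int.eq_ofNat_of_zero_le hm
    rw [sum_plusEntry_mul_plusEntry hr hr' hm, hB.sum_antidiagonal_mul_transpose]
    by_cases hdual : r' = dualMode r
    · obtain ⟨hdeg, hidx⟩ := eq_dualMode_iff.1 hdual
      rw [if_pos hdual, if_pos (by lia), hidx, Matrix.one_apply_eq, mul_one, hdual,
        modeParity_dualMode, neg_neg]
    · rw [if_neg hdual]
      split_ifs with h
      · rw [Matrix.one_apply_ne fun hidx => hdual (eq_dualMode_iff.2 ⟨by lia, hidx⟩), mul_zero]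
      · rw [Matrix.zero_apply, mul_zero]
  · rw [if_neg fun h => hm (eq_dualMode_iff.1 h).1.ge]
    refine Finset.sum_eq_zero fun p _ => ?_
    by_cases h₁ : deg p ≤ deg r
    · rw [plusEntry_of_lt (p := r') B (by rw [deg_dualMode]; lia), mul_zero, mul_zero]
    · rw [plusEntry_of_lt B (not_le.1 h₁), zero_mul, mul_zero]

theorem isFormPreserving_minusEntry {B : ℕ → Matrix (Fin n) (Fin n) ℂ}
    (hB : IsSymplecticSeries B) : IsFormPreserving (minusEntry B) := by
  intro N r hr r' hr'
  calc ∑ p ∈ window n N, modeParity p * (minusEntry B r p * minusEntry B r' (dualMode p))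
      = -∑ p ∈ window n N, modeParity p *
          (plusEntry B (dualMode r) p * plusEntry B (dualMode r') (dualMode p)) := by
        rw [← Finset.sum_neg_distrib]
        refine Finset.sum_equiv (Function.Involutive.toPerm dualMode dualMode_dualMode)
          (fun _ => dualMode_mem_window.symm) fun p _ => ?_
        change _ = -(modeParity (dualMode p) * (plusEntry B (dualMode r) (dualMode p) *
          plusEntry B (dualMode r') (dualMode (dualMode p))))
        rw [plusEntry_dualMode, plusEntry_dualMode, modeParity_dualMode, neg_mul, neg_neg]
    _ = if r' = dualMode r then modeParity r else 0 := by
        rw [isFormPreserving_plusEntry hB N _ (dualMode_mem_window.2 hr) _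
            (dualMode_mem_window.2 hr'), modeParity_dualMode, neg_ite, neg_neg, neg_zero]
        exact if_congr (Function.LeftInverse.injective dualMode_dualMode).eq_iff rfl rfl

theorem isStable_plusEntry {B : ℕ → Matrix (Fin n) (Fin n) ℂ} (hB : IsSymplecticSeries B) :
    IsStable (plusEntry B) := by
  refine isStable_of_blockTriangular (fun _ _ => plusEntry_of_lt B) fun N => ?_
  convert hB.det_ne_zero
  ext i j
  simp [plusEntry, deg_mode, idx_mode]

theorem isStable_minusEntry {B : ℕ → Matrix (Fin n) (Fin n) ℂ} (hB : IsSymplecticSeries B) :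
    IsStable (minusEntry B) := by
  refine IsStable.flip (T := flip (minusEntry B)) <|
    isStable_of_blockTriangular (fun _ _ h => if_neg h.not_ge) fun N => ?_
  rw [← Matrix.det_transpose]
  convert hB.det_ne_zero
  ext i j
  simp [minusEntry, deg_mode, idx_mode, flip]

namespace IsSymplecticOp

variable {A : Op n}

theorem intertwines_bilinearOp (hA : IsSymplecticOp A) :
    Intertwines bilinearOpT bilinearOp (matrixForm A) := by
  induction hA with
  | plus B hB => exact intertwines_bilinearOp_groupOp (isStable_plusEntry hB)
  | minus B hB => exact intertwines_bilinearOp_groupOp (isStable_minusEntry hB)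
  | mul M M' _ _ hfin hM hM' =>
    rcases hfin with hrows | hcols
    · exact intertwines_finsum_mul_of_finite_rows intertwines_bilinearOp_dotForm hM hM' hrows
    · exact intertwines_finsum_mul_of_finite_columns intertwines_bilinearOp_dotForm hM hM' hcols

theorem intertwines_symplecticOp (hA : IsSymplecticOp A) :
    Intertwines symplecticOpT symplecticOp (matrixForm A) := by
  induction hA with
  | plus B hB =>
    exact intertwines_symplecticOp_groupOp (isStable_plusEntry hB) (isFormPreserving_plusEntry hB)
  | minus B hB =>
    exact intertwines_symplecticOp_groupOp (isStable_minusEntry hB)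
      (isFormPreserving_minusEntry hB)
  | mul M M' _ _ hfin hM hM' =>
    rcases hfin with hrows | hcols
    · exact intertwines_finsum_mul_of_finite_rows intertwines_symplecticOp_dotForm hM hM' hrows
    · exact intertwines_finsum_mul_of_finite_columns intertwines_symplecticOp_dotForm hM hM' hcols

end IsSymplecticOp

section Derivation

variable {R ι V : Type*} [CommRing R] [AddCommGroup V] [Module R V]

/-- The extension of an operator to the tensor square by the Leibniz rule. -/
def derivation2 (D : Module.End R V) : Module.End R (V ⊗[R] V) :=
  TensorProduct.map D 1 + TensorProduct.map 1 D

theorem derivation2_tmul (D : Module.End R V) (f g : V) :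
    derivation2 D (f ⊗ₜ g) = D f ⊗ₜ g + f ⊗ₜ D g := rfl

theorem finsum_sub_comp_equiv {M : Type*} [AddCommGroup M] (e : ι ≃ ι) {u : ι → M}
    (hu : (Function.support u).Finite) : ∑ᶠ p, (u p - u (e p)) = 0 := by
  rw [finsum_sub_distrib hu, finsum_comp_equiv, sub_self]
  exact hu.preimage e.injective.injOn

theorem commute_derivation2_pairOp {X Y : ι → Module.End R V} (h : IsLocallyFinite X Y)
    {D : Module.End R V} {e : Equiv.Perm ι} {c : ι → R} (hc : ∀ p, c (e p) = c p)
    (hX : ∀ p f, D (X p f) = X p (D f) + c p • X (e p) f)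
    (hY : ∀ p f, D (Y p f) = Y p (D f) - c p • Y (e.symm p) f) :
    Commute (derivation2 D) (pairOp X Y h) := by
  refine TensorProduct.ext' fun f g => ?_
  let u : ι → V ⊗[R] V := fun p => c p • (X (e p) f ⊗ₜ[R] Y p g)
  have hu : (Function.support u).Finite := by
    have hsub : u = fun p => TensorProduct.map D 1 (X p f ⊗ₜ[R] Y p g) - X p (D f) ⊗ₜ[R] Y p g := by
      funext p
      simp only [u, TensorProduct.map_tmul, hX, TensorProduct.add_tmul, add_sub_cancel_left,
        Module.End.one_apply, TensorProduct.smul_tmul']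
    rw [hsub]
    exact (((h f g).subset (Function.support_comp_subset (map_zero _) _)).union
      (h (D f) g)).subset (Function.support_sub _ _)
  have hterm : ∀ p, derivation2 D (X p f ⊗ₜ[R] Y p g) =
      X p (D f) ⊗ₜ[R] Y p g + X p f ⊗ₜ[R] Y p (D g) + (u p - u (e.symm p)) := by
    intro p
    have hce : c (e.symm p) = c p := by rw [← hc, Equiv.apply_symm_apply]
    simp only [u, hce, Equiv.apply_symm_apply, derivation2_tmul, hX, hY, TensorProduct.add_tmul,
      TensorProduct.tmul_sub, TensorProduct.tmul_smul, TensorProduct.smul_tmul']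
    abel
  rw [Module.End.mul_apply, Module.End.mul_apply, derivation2_tmul, map_add, pairOp_tmul,
    pairOp_tmul, pairOp_tmul, map_finsum _ (h f g), finsum_congr hterm,
    finsum_add_distrib (((h _ _).union (h _ _)).subset (Function.support_add _ _))
      ((hu.union (hu.preimage e.symm.injective.injOn)).subset (Function.support_sub _ _)),
    finsum_add_distrib (h _ _) (h _ _), finsum_sub_comp_equiv _ hu, add_zero]

end Derivation

theorem finite_support_wedge_contract (i : Fin n) {k : ℤ} (hk : k ≠ 0) (f : Fock n) :
    (Function.support fun d : ℤ => wedge (mode i (d + k)) (contract (mode i d) f)).Finite := by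
  obtain ⟨b, hb⟩ := exists_wedge_eq_zero f
  obtain ⟨a, ha⟩ := exists_contract_eq_zero f
  refine (Set.finite_Icc a (b - k)).subset fun d hd => ⟨?_, ?_⟩ <;> by_contra! h <;> apply hd
  · simp [ha (mode i d) h]
  · have hne : mode i d ≠ mode i (d + k) := fun h => hk (by have := (mode_inj.1 h).2; lia)
    have hw : wedge (mode i (d + k)) f = 0 := hb _ (by rw [deg_mode]; lia)
    simpa [hw] using (contract_wedge hne f).symm

theorem leibniz_single_apply (i : Fin n) {k : ℤ} (hk : k ≠ 0) (f : Fock n) :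
    leibniz (Matrix.single i i 1) k f =
      ∑ᶠ d : ℤ, wedge (mode i (d + k)) (contract (mode i d) f) := by
  induction f using Finsupp.induction_linear with
  | zero => simp
  | add f g hf hg =>
    simp only [map_add, hf, hg]
    exact (finsum_add_distrib (finite_support_wedge_contract i hk f)
      (finite_support_wedge_contract i hk g)).symm
  | single v c =>
    rw [← Finsupp.smul_single_one, map_smul]
    simp only [map_smul]
    rw [← smul_finsum' c (finite_support_wedge_contract i hk _), leibniz,
      Finsupp.linearCombination_single, one_smul]
    congr 1
    refine finsum_congr fun d => ?_
    rw [Finset.sum_eq_single_of_mem i (Finset.mem_univ i)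
        fun j _ hj => by simp [hj.symm],
      Finset.sum_eq_single_of_mem i (Finset.mem_univ i)
        fun j _ hj => by simp [hj.symm],
      Matrix.single_apply_same, one_smul]

theorem isAdjointPair_leibniz_single (i : Fin n) {k : ℤ} (hk : k ≠ 0) :
    IsAdjointPair dotForm dotForm (leibniz (Matrix.single i i 1) (-k))
      (leibniz (Matrix.single i i 1) k) := by
  intro a f
  rw [dotForm_comm, leibniz_single_apply i hk, leibniz_single_apply i (neg_ne_zero.2 hk),
    map_finsum _ (finite_support_wedge_contract i (neg_ne_zero.2 hk) a),
    map_finsum _ (finite_support_wedge_contract i hk f),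
    ← finsum_comp_equiv (Equiv.addRight k)]
  refine finsum_congr fun d => ?_
  rw [Equiv.coe_addRight, add_neg_cancel_right, dotForm_comm, isAdjointPair_wedge_contract,
    isAdjointPair_contract_wedge]

/-- The bijection `e_i z^d ↦ e_i z^(d+k)` of the basis vectors. -/
def shift (k : ℤ) : Equiv.Perm (Mode n) where
  toFun p := mode (idx p) (deg p + k)
  invFun p := mode (idx p) (deg p - k)
  left_inv p := by simp [deg_mode, idx_mode, mode_idx_deg]
  right_inv p := by simp [deg_mode, idx_mode, mode_idx_deg]

theorem shift_neg (k : ℤ) : shift (n := n) (-k) = (shift k).symm := Equiv.ext fun _ => rfl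

theorem leibniz_wedge (i : Fin n) {k : ℤ} (hk : k ≠ 0) (q : Mode n) (f : Fock n) :
    leibniz (Matrix.single i i 1) k (wedge q f) =
      wedge q (leibniz (Matrix.single i i 1) k f) +
        (if idx q = i then (1 : ℂ) else 0) • wedge (shift k q) f := by
  have hterm : ∀ d : ℤ, wedge (mode i (d + k)) (contract (mode i d) (wedge q f)) =
      wedge q (wedge (mode i (d + k)) (contract (mode i d) f)) +
        if mode i d = q then wedge (shift k q) f else 0 := by
    intro d
    by_cases h : mode i d = q
    · subst h
      rw [if_pos rfl, contract_wedge_self, map_sub, wedge_wedge _ (mode i d), sub_neg_eq_add,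
        add_comm]
      rfl
    · rw [if_neg h, contract_wedge h, map_neg, wedge_wedge _ q, neg_neg, add_zero]
  have hmode : ∀ d ≠ deg q, (if mode i d = q then wedge (shift k q) f else 0) = 0 :=
    fun d hd => if_neg fun h => hd (by rw [← h, deg_mode])
  have hfin : (Function.support fun d =>
      wedge q (wedge (mode i (d + k)) (contract (mode i d) f))).Finite :=
    (finite_support_wedge_contract i hk f).subset (Function.support_comp_subset (map_zero _) _)
  rw [leibniz_single_apply i hk, leibniz_single_apply i hk,
    map_finsum _ (finite_support_wedge_contract i hk f), finsum_congr hterm,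
    finsum_add_distrib hfin
      ((Set.finite_singleton (deg q)).subset fun d hd => not_not.1 fun h => hd (hmode d h)),
    finsum_eq_single _ (deg q) hmode, ite_smul, one_smul, zero_smul]
  refine congrArg _ (if_congr ?_ rfl rfl)
  rw [← mode_idx_deg q, mode_inj, idx_mode, deg_mode, eq_comm]
  exact and_iff_left rfl

theorem leibniz_contract (i : Fin n) {k : ℤ} (hk : k ≠ 0) (q : Mode n) (f : Fock n) :
    leibniz (Matrix.single i i 1) k (contract q f) =
      contract q (leibniz (Matrix.single i i 1) k f) -
        (if idx q = i then (1 : ℂ) else 0) • contract ((shift k).symm q) f := by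
  refine eq_of_dotForm_eq fun a => ?_
  have hadj := isAdjointPair_leibniz_single (n := n) i hk
  rw [← hadj, ← isAdjointPair_wedge_contract, map_sub, map_smul, ← isAdjointPair_wedge_contract,
    ← isAdjointPair_wedge_contract, ← hadj, leibniz_wedge i (neg_ne_zero.2 hk), map_add, map_smul,
    shift_neg, LinearMap.add_apply, LinearMap.smul_apply, add_sub_cancel_right]

theorem commute_leibniz_bilinearOp (i : Fin n) {k : ℤ} (hk : k ≠ 0) :
    Commute (derivation2 (leibniz (Matrix.single i i 1) k)) bilinearOp :=
  commute_derivation2_pairOp _ (fun _ => rfl) (leibniz_wedge i hk) (leibniz_contract i hk)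

theorem commute_leibniz_symplecticOp (i : Fin n) {k : ℤ} (hk : Odd k) :
    Commute (derivation2 (leibniz (Matrix.single i i 1) k)) symplecticOp := by
  have hk0 : k ≠ 0 := by rintro rfl; simp at hk
  refine commute_derivation2_pairOp _ (fun _ => rfl) (leibniz_wedge i hk0) fun p f => ?_
  have hdual : dualMode ((shift k).symm p) = shift k (dualMode p) :=
    congrArg (mode _) (by change -1 - (deg p - k) = -1 - deg p + k; ring)
  have hparity : modeParity ((shift k).symm p) = -modeParity p := by
    change (-1 : ℂ) ^ (deg p - k) = -(-1) ^ deg p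
    rw [zpow_sub₀ (by norm_num), hk.neg_one_zpow, div_neg, div_one]
  rw [LinearMap.smul_apply, LinearMap.smul_apply, LinearMap.smul_apply, map_smul,
    leibniz_wedge i hk0, hdual, hparity, neg_smul, smul_neg, sub_neg_eq_add, smul_add, smul_comm]
  rfl

section Exponential

theorem sum_antidiagonal_prod_ofFn {R : Type*} [Semiring R] {n : ℕ} (F G : Fin n → ℕ → R)
    (hFG : ∀ i j a b, Commute (F i a) (G j b)) (m : Fin n →₀ ℕ) :
    ∑ x ∈ Finset.HasAntidiagonal.antidiagonal m,
        (List.ofFn fun i => F i (x.1 i)).prod * (List.ofFn fun i => G i (x.2 i)).prod =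
      (List.ofFn fun i =>
        ∑ y ∈ Finset.HasAntidiagonal.antidiagonal (m i), F i y.1 * G i y.2).prod := by
  induction n with
  | zero =>
    obtain rfl := Subsingleton.elim m 0
    simp
  | succ n ih =>
    have htail := ih (fun i => F i.succ) (fun i => G i.succ) (fun i j => hFG _ _) m.tail
    simp only [Finsupp.tail_apply] at htail
    rw [List.ofFn_succ, List.prod_cons, ← htail, Finset.sum_mul_sum, ← Finset.sum_product']
    refine Finset.sum_bij' (fun x _ => ((x.1 0, x.2 0), (x.1.tail, x.2.tail)))
      (fun y _ => (y.2.1.cons y.1.1, y.2.2.cons y.1.2)) ?_ ?_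
      (by simp [Finsupp.cons_tail]) (by simp [Finsupp.tail_cons]) ?_
    · intro x hx
      rw [Finset.HasAntidiagonal.mem_antidiagonal] at hx
      simp only [Finset.mem_product, Finset.HasAntidiagonal.mem_antidiagonal, ← hx]
      exact ⟨rfl, Finsupp.ext fun _ => rfl⟩
    · rintro ⟨y, z⟩ hy
      simp only [Finset.mem_product, Finset.HasAntidiagonal.mem_antidiagonal] at hy
      rw [Finset.HasAntidiagonal.mem_antidiagonal]
      ext j
      refine Fin.cases ?_ (fun j => ?_) j
      · simpa using hy.1
      · simpa [Finsupp.tail_apply] using DFunLike.congr_fun hy.2 j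
    · intro x _
      have hcomm :
          Commute (List.ofFn fun i : Fin n => F i.succ (x.1 i.succ)).prod (G 0 (x.2 0)) := by
        refine Commute.list_prod_left _ _ fun y hy => ?_
        obtain ⟨i, rfl⟩ := (List.mem_ofFn' _ _).1 hy
        exact hFG _ _ _ _
      simp only [List.ofFn_succ, List.prod_cons, Finsupp.tail_apply]
      rw [mul_assoc, ← mul_assoc _ (G 0 _), hcomm.eq]
      simp only [mul_assoc]

variable {R : Type*} [Semiring R] [Algebra ℂ R]

theorem sum_antidiagonal_inv_factorial_smul_pow {x y : R} (h : Commute x y) (k : ℕ) :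
    ∑ z ∈ Finset.HasAntidiagonal.antidiagonal k,
        ((z.1.factorial : ℂ)⁻¹ • x ^ z.1) * ((z.2.factorial : ℂ)⁻¹ • y ^ z.2) =
      (k.factorial : ℂ)⁻¹ • (x + y) ^ k := by
  rw [h.add_pow', Finset.smul_sum]
  refine Finset.sum_congr rfl fun z hz => ?_
  obtain rfl := Finset.HasAntidiagonal.mem_antidiagonal.1 hz
  rw [smul_mul_smul_comm, ← Nat.cast_smul_eq_nsmul ℂ, smul_smul, Nat.cast_add_choose]
  congr 1
  field_simp [Nat.factorial_ne_zero]

end Exponential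

section Adjoint

variable {R V : Type*} [CommSemiring R] [AddCommMonoid V] [Module R V] {B : BilinForm R V}
  {X Y Xt Yt : Module.End R V}

theorem isAdjointPair_map (hX : IsAdjointPair B B Xt X) (hY : IsAdjointPair B B Yt Y) :
    IsAdjointPair (B.tmul B) (B.tmul B) (TensorProduct.map Xt Yt) (TensorProduct.map X Y) := by
  rw [LinearMap.isAdjointPair_iff_comp_eq_compl₂]
  ext a a' b b'
  simp [hX _ _, hY _ _]

theorem isAdjointPair_pow (h : IsAdjointPair B B Xt X) (k : ℕ) :
    IsAdjointPair B B (Xt ^ k : Module.End R V) (X ^ k : Module.End R V) := by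
  induction k with
  | zero => exact LinearMap.isAdjointPair_one
  | succ k ih => rw [pow_succ', pow_succ]; exact h.mul ih

theorem isAdjointPair_prod_ofFn {n : ℕ} {F Ft : Fin n → Module.End R V}
    (h : ∀ i, IsAdjointPair B B (Ft i) (F i)) :
    IsAdjointPair B B (List.ofFn Ft).reverse.prod (List.ofFn F).prod := by
  induction n with
  | zero => simpa using LinearMap.isAdjointPair_one
  | succ n ih =>
    simp only [List.ofFn_succ, List.reverse_cons, List.prod_append, List.prod_cons, List.prod_nil,
      mul_one]
    exact (ih fun i => h i.succ).mul (h 0)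

theorem commute_of_isAdjointPair (hB : Function.Injective B) (hX : IsAdjointPair B B Xt X)
    (hY : IsAdjointPair B B Yt Y) (h : Commute X Y) : Commute Xt Yt :=
  LinearMap.ext fun a => hB <| LinearMap.ext fun b => by
    rw [Module.End.mul_apply, Module.End.mul_apply, hX, hY, hY, hX, ← Module.End.mul_apply, ← h.eq,
      Module.End.mul_apply]

end Adjoint

/-- The coefficient at `u^m` of the action of `exp (∑ i, α_i u_i)` on the tensor square. -/
def expAlpha2 (m : Fin n →₀ ℕ) : Module.End ℂ (Fock n ⊗[ℂ] Fock n) :=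
  ∑ x ∈ Finset.HasAntidiagonal.antidiagonal m, TensorProduct.map (expAlpha x.1) (expAlpha x.2)

theorem expAlpha2_eq_prod (m : Fin n →₀ ℕ) :
    expAlpha2 m =
      (List.ofFn fun i : Fin n => ((m i).factorial : ℂ)⁻¹ • derivation2 (alpha i) ^ m i).prod := by
  let l := Module.End.rTensorAlgHom ℂ (Fock n) (Fock n)
  let r := Module.End.lTensorAlgHom ℂ (Fock n) (Fock n)
  have hlr : ∀ X Y, TensorProduct.map X Y = l X * r Y :=
    fun X Y => TensorProduct.ext' fun _ _ => rfl
  have hcomm : ∀ X Y, Commute (l X) (r Y) := fun X Y => TensorProduct.ext' fun _ _ => rfl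
  have hd : ∀ i : Fin n, derivation2 (alpha i) = l (alpha i) + r (alpha i) := fun i => rfl
  have hpow := fun (i : Fin n) (k : ℕ) => sum_antidiagonal_inv_factorial_smul_pow
    (R := Module.End ℂ (Fock n ⊗[ℂ] Fock n)) (hcomm (alpha i) (alpha i)) k
  simp only [hd, ← hpow]
  rw [← sum_antidiagonal_prod_ofFn
    (fun i k => (k.factorial : ℂ)⁻¹ • l (alpha i) ^ k)
    (fun i k => (k.factorial : ℂ)⁻¹ • r (alpha i) ^ k)
    (fun i j a b => (((hcomm _ _).pow_pow a b).smul_left _).smul_right _), expAlpha2]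
  refine Finset.sum_congr rfl fun x _ => ?_
  rw [hlr, expAlpha, expAlpha, map_list_prod, map_list_prod, List.map_ofFn, List.map_ofFn]
  simp only [Function.comp_def, map_smul, map_pow]

theorem commute_expAlpha2 {Ω : Module.End ℂ (Fock n ⊗[ℂ] Fock n)}
    (h : ∀ i, Commute (derivation2 (alpha i)) Ω) (m : Fin n →₀ ℕ) :
    Commute (expAlpha2 m) Ω := by
  rw [expAlpha2_eq_prod]
  refine Commute.list_prod_left _ _ fun y hy => ?_
  obtain ⟨i, rfl⟩ := (List.mem_ofFn' _ _).1 hy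
  exact ((h i).pow_left _).smul_left _

/-- The transpose of `expAlpha m` with respect to `dotForm`. -/
def expAlphaT (m : Fin n →₀ ℕ) : Module.End ℂ (Fock n) :=
  (List.ofFn fun i : Fin n =>
    ((m i).factorial : ℂ)⁻¹ • leibniz (Matrix.single i i 1) (-1) ^ m i).reverse.prod

theorem isAdjointPair_expAlpha (m : Fin n →₀ ℕ) :
    IsAdjointPair dotForm dotForm (expAlphaT m) (expAlpha m) :=
  isAdjointPair_prod_ofFn fun i =>
    (isAdjointPair_pow (isAdjointPair_leibniz_single i one_ne_zero) (m i)).smul _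

/-- The transpose of `expAlpha2 m`. -/
def expAlphaT2 (m : Fin n →₀ ℕ) : Module.End ℂ (Fock n ⊗[ℂ] Fock n) :=
  ∑ x ∈ Finset.HasAntidiagonal.antidiagonal m, TensorProduct.map (expAlphaT x.1) (expAlphaT x.2)

theorem isAdjointPair_expAlpha2 (m : Fin n →₀ ℕ) :
    IsAdjointPair (BilinForm.tmul dotForm dotForm) (BilinForm.tmul dotForm dotForm)
      (expAlphaT2 m) (expAlpha2 m) := fun s t => by
  simp only [expAlphaT2, expAlpha2, LinearMap.sum_apply, map_sum]
  exact Finset.sum_congr rfl fun x _ =>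
    isAdjointPair_map (isAdjointPair_expAlpha x.1) (isAdjointPair_expAlpha x.2) s t

theorem commute_expAlphaT2 {Ωt Ω : Module.End ℂ (Fock n ⊗[ℂ] Fock n)}
    (hΩ : Intertwines Ωt Ω dotForm) (h : ∀ i, Commute (derivation2 (alpha i)) Ω)
    (m : Fin n →₀ ℕ) : Commute (expAlphaT2 m) Ωt := by
  refine commute_of_isAdjointPair ?_ (isAdjointPair_expAlpha2 m) hΩ (commute_expAlpha2 h m)
  simpa only [tmul_flip, dotForm_flip] using flip_dotForm_tmul_injective (R := ℂ) (ι := Maya n)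

theorem coeff_matrixElement (A : Op n) (a b : Fock n) (m : Fin n →₀ ℕ) :
    MvPowerSeries.coeff m (matrixElement A a b) = matrixForm A (expAlphaT m a) b := by
  have hx : ∀ x, pairing a (expAlpha m (Finsupp.single x 1)) = expAlphaT m a x := fun x => by
    have hpairing : ∀ b, pairing a b = dotForm a b := fun b => by
      simp [pairing, dotForm, Finsupp.linearCombination_apply, Finsupp.sum, LinearMap.sum_apply]
    rw [hpairing, ← isAdjointPair_expAlpha, dotForm_single_right, one_mul]
  change ∑ᶠ x, _ = _
  simp only [hx]
  rw [matrixForm_apply, finsum_eq_sum_of_support_subset]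
  · rfl
  · exact fun x hx => Finsupp.mem_support_iff.2 (left_ne_zero_of_mul hx)

/-- The matrix elements of `exp (∑ i, α_i u_i) A` as a bilinear map. -/
def element (A : Op n) : Fock n →ₗ[ℂ] Fock n →ₗ[ℂ] MvPowerSeries (Fin n) ℂ :=
  LinearMap.mk₂ ℂ (matrixElement A)
    (fun _ _ _ => by ext m; simp [coeff_matrixElement])
    (fun _ _ _ => by ext m; simp [coeff_matrixElement])
    (fun _ _ _ => by ext m; simp [coeff_matrixElement])
    (fun _ _ _ => by ext m; simp [coeff_matrixElement])

theorem coeff_element (A : Op n) (a b : Fock n) (m : Fin n →₀ ℕ) :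
    MvPowerSeries.coeff m (element A a b) = matrixForm A (expAlphaT m a) b :=
  coeff_matrixElement A a b m

/-- The matrix elements of the tensor square of `exp (∑ i, α_i u_i) A`. -/
def element2 (A : Op n) :
    Fock n ⊗[ℂ] Fock n →ₗ[ℂ] Fock n ⊗[ℂ] Fock n →ₗ[ℂ] MvPowerSeries (Fin n) ℂ :=
  (LinearMap.BilinMap.tmul (element A) (element A)).compr₂ (LinearMap.mul' ℂ _)

theorem element2_tmul (A : Op n) (a a' b b' : Fock n) :
    element2 A (a ⊗ₜ a') (b ⊗ₜ b') = element A a b * element A a' b' := rfl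

theorem coeff_element2 (A : Op n) (s t : Fock n ⊗[ℂ] Fock n) (m : Fin n →₀ ℕ) :
    MvPowerSeries.coeff m (element2 A s t) =
      BilinForm.tmul (matrixForm A) (matrixForm A) (expAlphaT2 m s) t := by
  induction s using TensorProduct.induction_on with
  | zero => simp
  | add s s' hs hs' => simp only [map_add, LinearMap.add_apply, hs, hs']
  | tmul a a' =>
    induction t using TensorProduct.induction_on with
    | zero => simp
    | add t t' ht ht' => simp only [map_add, ht, ht']
    | tmul b b' =>
      simp only [element2_tmul, MvPowerSeries.coeff_mul, coeff_element, expAlphaT2,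
        LinearMap.sum_apply, map_sum, TensorProduct.map_tmul, tmul_apply_tmul]

theorem isAdjointPair_element2 {A : Op n} {Ωt Ω : Module.End ℂ (Fock n ⊗[ℂ] Fock n)}
    (hΩ : Intertwines Ωt Ω dotForm) (h : ∀ i, Commute (derivation2 (alpha i)) Ω)
    (hA : Intertwines Ωt Ω (matrixForm A)) : IsAdjointPair (element2 A) (element2 A) Ωt Ω := by
  intro s t
  ext m
  rw [coeff_element2, coeff_element2, ← hA, ← Module.End.mul_apply,
    (commute_expAlphaT2 hΩ h m).eq, Module.End.mul_apply]

namespace IsSymplecticOp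

variable {A : Op n}

theorem element2_bilinearOp (hA : IsSymplecticOp A) (s t : Fock n ⊗[ℂ] Fock n) :
    element2 A (bilinearOpT s) t = element2 A s (bilinearOp t) :=
  isAdjointPair_element2 intertwines_bilinearOp_dotForm
    (fun i => commute_leibniz_bilinearOp i one_ne_zero) hA.intertwines_bilinearOp s t

theorem element2_symplecticOp (hA : IsSymplecticOp A) (s t : Fock n ⊗[ℂ] Fock n) :
    element2 A (symplecticOpT s) t = element2 A s (symplecticOp t) :=
  isAdjointPair_element2 intertwines_symplecticOp_dotForm
    (fun i => commute_leibniz_symplecticOp i odd_one) hA.intertwines_symplecticOp s t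

end IsSymplecticOp

variable {A : Op n}

theorem wedge_contract_vac_self {q : Mode n} (hq : 0 ≤ deg q) :
    wedge q (contract q vac) = vac := by
  have h := contract_wedge_self q vac
  rw [wedge_vac hq, map_zero] at h
  exact (sub_eq_zero.1 h.symm).symm

theorem contract_wedge_vac_self {p : Mode n} (hp : deg p < 0) :
    contract p (wedge p vac) = vac := by
  rw [contract_wedge_self, contract_vac hp, map_zero, sub_zero]

theorem wedge_contract_vac_of_ne {p q : Mode n} (hpq : p ≠ q) (hp : 0 ≤ deg p) :
    wedge p (contract q vac) = 0 := by
  rw [← neg_neg (wedge _ _), ← contract_wedge hpq.symm, wedge_vac hp, map_zero, neg_zero]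

theorem contract_wedge_vac_of_ne {p q : Mode n} (hpq : p ≠ q) (hp : deg p < 0) :
    contract p (wedge q vac) = 0 := by
  rw [contract_wedge hpq, contract_vac hp, map_zero, neg_zero]

theorem bilinearOp_contract_wedge_vac {p q : Mode n} (hp : deg p < 0) (hq : 0 ≤ deg q) :
    bilinearOp (contract q vac ⊗ₜ wedge p vac) =
      wedge p (contract q vac) ⊗ₜ vac - vac ⊗ₜ wedge p (contract q vac) := by
  have hpq : p ≠ q := fun h => (h ▸ hp).not_ge hq
  have hsupp : (Function.support fun k =>
      wedge k (contract q vac) ⊗ₜ[ℂ] contract k (wedge p vac)) ⊆ ({p, q} : Finset (Mode n)) := by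
    intro k hk
    by_contra hkpq
    simp only [Finset.coe_insert, Finset.coe_singleton, Set.mem_insert_iff,
      Set.mem_singleton_iff, not_or] at hkpq
    refine hk ?_
    rcases lt_or_ge (deg k) 0 with hk0 | hk0
    · simp only [contract_wedge_vac_of_ne hkpq.1 hk0, TensorProduct.tmul_zero]
    · simp only [wedge_contract_vac_of_ne hkpq.2 hk0, TensorProduct.zero_tmul]
  rw [bilinearOp, pairOp_tmul, finsum_eq_sum_of_support_subset _ hsupp, Finset.sum_pair hpq,
    wedge_contract_vac_self hq, contract_wedge_vac_self hp, contract_wedge hpq.symm,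
    TensorProduct.tmul_neg, sub_eq_add_neg]

theorem bilinearOpT_wedge_contract_vac {p q : Mode n} (hp : deg p < 0) :
    bilinearOpT (wedge p (contract q vac) ⊗ₜ vac) = contract q vac ⊗ₜ wedge p vac := by
  rw [bilinearOpT, pairOp_tmul, finsum_eq_single _ p]
  · rw [contract_wedge_self, contract_contract, contract_vac hp, map_zero, neg_zero, map_zero,
      sub_zero]
  · intro k hk
    rcases lt_or_ge (deg k) 0 with hk0 | hk0
    · rw [contract_wedge hk, contract_contract, contract_vac hk0, map_zero, neg_zero, map_zero,
        neg_zero, TensorProduct.zero_tmul]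
    · rw [wedge_vac hk0, TensorProduct.tmul_zero]

theorem symplecticOp_contract_vac {q : Mode n} (hq : 0 ≤ deg q) :
    symplecticOp (contract q vac ⊗ₜ vac) = modeParity q • vac ⊗ₜ wedge (dualMode q) vac := by
  rw [symplecticOp, pairOp_tmul, finsum_eq_single _ q, wedge_contract_vac_self hq,
    LinearMap.smul_apply, TensorProduct.tmul_smul]
  intro k hk
  rcases lt_or_ge (deg k) 0 with hk0 | hk0
  · rw [LinearMap.smul_apply, wedge_vac (p := dualMode k) (by rw [deg_dualMode]; lia), smul_zero,
      TensorProduct.tmul_zero]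
  · rw [wedge_contract_vac_of_ne hk hk0, TensorProduct.zero_tmul]

theorem symplecticOpT_wedge_vac {q : Mode n} (hq : 0 ≤ deg q) :
    symplecticOpT (vac ⊗ₜ wedge (dualMode q) vac) = modeParity q • contract q vac ⊗ₜ vac := by
  have hq' : deg (dualMode q) < 0 := by rw [deg_dualMode]; lia
  rw [symplecticOpT, pairOp_tmul, finsum_eq_single _ q, LinearMap.smul_apply,
    contract_wedge_vac_self hq', TensorProduct.tmul_smul]
  intro k hk
  have hk' : dualMode k ≠ dualMode q := (Function.LeftInverse.injective dualMode_dualMode).ne hk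
  rcases lt_or_ge (deg k) 0 with hk0 | hk0
  · rw [contract_vac hk0, TensorProduct.zero_tmul]
  · rw [LinearMap.smul_apply, contract_wedge_vac_of_ne hk' (by rw [deg_dualMode]; lia), smul_zero,
      TensorProduct.tmul_zero]

namespace IsSymplecticOp

theorem element_plucker (hA : IsSymplecticOp A) {p q p' : Mode n}
    (hp : deg p < 0) (hq : 0 ≤ deg q) (hp' : deg p' < 0) (q' : Mode n) :
    element A (wedge p' (contract q' vac)) (wedge p (contract q vac)) * element A vac vac -
        element A (wedge p' (contract q' vac)) vac * element A vac (wedge p (contract q vac)) =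
      element A (contract q' vac) (contract q vac) * element A (wedge p' vac) (wedge p vac) := by
  have h := hA.element2_bilinearOp (wedge p' (contract q' vac) ⊗ₜ vac)
    (contract q vac ⊗ₜ wedge p vac)
  rw [bilinearOpT_wedge_contract_vac hp', bilinearOp_contract_wedge_vac hp hq, map_sub] at h
  simpa only [element2_tmul] using h.symm

theorem element_contract_vac (hA : IsSymplecticOp A)
    (hτ : matrixElement A vac vac ≠ 0) {q q' : Mode n} (hq : 0 ≤ deg q) (hq' : 0 ≤ deg q') :
    modeParity q' • element A (contract q' vac) (contract q vac) =
      modeParity q • element A (wedge (dualMode q') vac) (wedge (dualMode q) vac) := by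
  have h := hA.element2_symplecticOp (vac ⊗ₜ wedge (dualMode q') vac) (contract q vac ⊗ₜ vac)
  rw [symplecticOpT_wedge_vac hq', symplecticOp_contract_vac hq, map_smul, map_smul,
    LinearMap.smul_apply, element2_tmul, element2_tmul] at h
  refine mul_left_cancel₀ (a := element A vac vac) hτ ?_
  rw [mul_smul_comm, mul_smul_comm, ← h, mul_comm]

end IsSymplecticOp

section LeibnizVac

variable {m : Matrix (Fin n) (Fin n) ℂ} {k : ℤ}

theorem HasParity.trace_eq_zero {ℓ : ℕ} (h : HasParity ℓ m) (hℓ : Even ℓ) : m.trace = 0 := by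
  rw [← self_eq_neg, ← Matrix.trace_neg, ← h.2 hℓ, Matrix.trace_transpose]

theorem sum_wedge_contract_vac (hm : k = 0 → m.trace = 0) {d : ℤ} (hd : 0 ≤ d + k) :
    ∑ i, ∑ j, m i j • wedge (mode i (d + k)) (contract (mode j d) vac) = 0 := by
  by_cases hk : k = 0
  · subst hk
    have hne : ∀ i j, j ≠ i → m i j • wedge (mode i (d + 0)) (contract (mode j d) vac) = 0 :=
      fun i j hij => by
        rw [wedge_contract_vac_of_ne (fun h => hij (mode_inj.1 h).1.symm) hd, smul_zero]
    simp only [Finset.sum_eq_single_of_mem _ (Finset.mem_univ _) fun j _ => hne _ j]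
    simp only [add_zero] at hd ⊢
    simp only [wedge_contract_vac_self (q := mode _ d) hd, ← Finset.sum_smul]
    exact (congrArg (· • vac) (hm rfl)).trans (zero_smul ℂ _)
  · refine Finset.sum_eq_zero fun i _ => Finset.sum_eq_zero fun j _ => ?_
    have hne : mode i (d + k) ≠ mode j d := fun h => hk (add_eq_left.1 (mode_inj.1 h).2)
    rw [wedge_contract_vac_of_ne hne hd, smul_zero]

theorem sum_wedge_contract_vac_of_neg (m : Matrix (Fin n) (Fin n) ℂ) (k : ℤ) {d : ℤ} (hd : d < 0) :
    ∑ i, ∑ j, m i j • wedge (mode i (d + k)) (contract (mode j d) vac) = 0 := by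
  simp only [contract_vac (p := mode _ d) hd, map_zero, smul_zero, Finset.sum_const_zero]

theorem leibniz_vac_eq_sum (hm : k = 0 → m.trace = 0) :
    leibniz m k vac = ∑ d ∈ Finset.range (-k).toNat, ∑ i, ∑ j,
      m i j • wedge (mode i (d + k)) (contract (mode j d) vac) := by
  rw [leibniz, vac, Finsupp.linearCombination_single, one_smul, ← vac,
    finsum_eq_sum_of_support_subset (s := (Finset.range (-k).toNat).map Nat.castEmbedding),
    Finset.sum_map]
  · rfl
  · intro d hd
    have hd0 : 0 ≤ d := not_lt.1 fun h => hd (sum_wedge_contract_vac_of_neg m k h)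
    have hdk : d + k < 0 := not_le.1 fun h => hd (sum_wedge_contract_vac hm h)
    exact Finset.mem_coe.2 <| Finset.mem_map.2
      ⟨d.toNat, Finset.mem_range.2 (by lia), Int.toNat_of_nonneg hd0⟩

theorem leibniz_vac_of_nonneg (hm : k = 0 → m.trace = 0) (hk : 0 ≤ k) : leibniz m k vac = 0 := by
  rw [leibniz_vac_eq_sum hm, Int.toNat_of_nonpos (by lia), Finset.range_zero, Finset.sum_empty]

end LeibnizVac

section Deformation

variable (A : Op n) (X : Module.End ℂ (Fock n))

theorem expDeformation_zero : expDeformation A X 0 = A := by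
  funext w v
  simp [expDeformation]

theorem matrixElement_expDeformation_one (a : Fock n) :
    matrixElement (expDeformation A X 1) a vac = element A a (X vac) := by
  funext m
  refine finsum_congr fun x => congrArg _ ?_
  rw [vac, Finsupp.sum_single_index (mul_zero _), mul_one]
  simp only [expDeformation, Nat.factorial_one, Nat.cast_one, inv_one, one_smul, pow_one]

theorem coeff_zero_familyElement_expDeformation (a b : Fock n) :
    PowerSeries.coeff 0 (familyElement (expDeformation A X) a b) =
      algebraMap _ (K n) (element A a b) := by
  rw [familyElement, PowerSeries.coeff_mk, expDeformation_zero]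
  rfl

theorem coeff_one_familyElement_expDeformation (a : Fock n) :
    PowerSeries.coeff 1 (familyElement (expDeformation A X) a vac) =
      algebraMap _ (K n) (element A a (X vac)) := by
  rw [familyElement, PowerSeries.coeff_mk, matrixElement_expDeformation_one]

theorem ddε_neg_mul_inv (N D : PowerSeries (K n)) (hD : PowerSeries.coeff 0 D ≠ 0) :
    ddε (-N * D⁻¹) =
      -(PowerSeries.coeff 1 N * PowerSeries.coeff 0 D -
        PowerSeries.coeff 0 N * PowerSeries.coeff 1 D) / PowerSeries.coeff 0 D ^ 2 := by
  have hinv : PowerSeries.constantCoeff D⁻¹ = (PowerSeries.constantCoeff D)⁻¹ :=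
    PowerSeries.constantCoeff_inv D
  rw [PowerSeries.coeff_zero_eq_constantCoeff_apply] at hD
  have hcoeff : ∀ f : PowerSeries (K n),
      PowerSeries.constantCoeff (PowerSeries.derivative (K n) f) = PowerSeries.coeff 1 f :=
    fun f => by
      rw [← PowerSeries.coeff_zero_eq_constantCoeff_apply, PowerSeries.coeff_derivative]
      simp
  rw [ddε, Derivation.leibniz, PowerSeries.derivative_inv']
  simp only [map_add, map_neg, map_mul, smul_eq_mul, map_pow, hinv, hcoeff,
    PowerSeries.coeff_zero_eq_constantCoeff_apply]
  field_simp
  ring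

end Deformation

section Variation

theorem ddε_gamma_expDeformation (hτ : matrixElement A vac vac ≠ 0)
    (X : Module.End ℂ (Fock n)) (i j : Fin n) :
    ddε (gamma (expDeformation A X) i j) =
      -algebraMap _ (K n)
        (element A (wedge (mode i (-1)) (contract (mode j 0) vac)) (X vac) * element A vac vac -
          element A (wedge (mode i (-1)) (contract (mode j 0) vac)) vac *
            element A vac (X vac)) /
        algebraMap _ (K n) (element A vac vac) ^ 2 := by
  have hτ' : algebraMap _ (K n) (element A vac vac) ≠ 0 :=
    (FaithfulSMul.algebraMap_eq_zero_iff _ _).not.2 hτ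
  rw [gamma, Matrix.of_apply, ddε_neg_mul_inv]
  · simp only [coeff_zero_familyElement_expDeformation, coeff_one_familyElement_expDeformation,
      map_sub, map_mul]
  · rwa [coeff_zero_familyElement_expDeformation]

theorem gamma_map_ddε_leibniz_of_nonneg (hτ : matrixElement A vac vac ≠ 0)
    {m : Matrix (Fin n) (Fin n) ℂ} {k : ℤ} (hm : k = 0 → m.trace = 0) (hk : 0 ≤ k) :
    (gamma (expDeformation A (leibniz m k))).map ddε = 0 := by
  ext i j
  rw [Matrix.map_apply, ddε_gamma_expDeformation hτ, leibniz_vac_of_nonneg hm hk]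
  simp only [map_zero, zero_mul, mul_zero, sub_zero, neg_zero, zero_div, Matrix.zero_apply]

theorem Psi_apply (A : Op n) (d : ℕ) (i j : Fin n) :
    Psi A d i j =
      algebraMap _ (K n) (element A (wedge (mode i (-1)) vac) (wedge (mode j (-1 - d)) vac)) /
        algebraMap _ (K n) (element A vac vac) := rfl

theorem neg_one_zpow_natCast_sub_one {F : Type*} [DivisionRing F] (d : ℕ) :
    (-1 : F) ^ ((d : ℤ) - 1) = -(-1) ^ d := by
  rw [zpow_sub_one₀ (neg_ne_zero.2 one_ne_zero), zpow_natCast, inv_neg, inv_one, mul_neg_one]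

theorem sum_filter_add_add_one_eq {M : Type*} [AddCommMonoid M] (ℓ : ℕ) (F : ℕ × ℕ → M) :
    ∑ p ∈ (Finset.range ℓ ×ˢ Finset.range ℓ).filter (fun p => p.1 + p.2 + 1 = ℓ), F p =
      ∑ d ∈ Finset.range ℓ, F (ℓ - 1 - d, d) := by
  refine Finset.sum_nbij' Prod.snd (fun d => (ℓ - 1 - d, d)) ?_ ?_ ?_ ?_ ?_ <;>
    simp +contextual [Prod.ext_iff] <;> grind

namespace IsSymplecticOp

theorem element_wedge_contract_vac (hA : IsSymplecticOp A) (hτ : matrixElement A vac vac ≠ 0)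
    (a b i j : Fin n) (d : ℕ) {e : ℤ} (he : e < 0) :
    element A (wedge (mode i (-1)) (contract (mode j 0) vac))
          (wedge (mode a e) (contract (mode b d) vac)) * element A vac vac -
        element A (wedge (mode i (-1)) (contract (mode j 0) vac)) vac *
          element A vac (wedge (mode a e) (contract (mode b d) vac)) =
      (-1 : ℂ) ^ d • (element A (wedge (mode i (-1)) vac) (wedge (mode a e) vac) *
        element A (wedge (mode j (-1)) vac) (wedge (mode b (-1 - d)) vac)) := by
  have hd : 0 ≤ deg (mode b (d : ℤ)) := Int.natCast_nonneg d
  have hdual := hA.element_contract_vac hτ hd (le_refl (deg (mode j 0)))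
  rw [modeParity, modeParity, deg_mode, deg_mode, zpow_zero, one_smul, zpow_natCast] at hdual
  rw [hA.element_plucker (p := mode a e) he hd (p' := mode i (-1)) neg_one_lt_zero, hdual,
    smul_mul_assoc, mul_comm]
  rfl

theorem gamma_map_ddε_leibniz_neg (hA : IsSymplecticOp A) (hτ : matrixElement A vac vac ≠ 0)
    {m : Matrix (Fin n) (Fin n) ℂ} {ℓ : ℕ} (hm : ℓ = 0 → m.trace = 0) :
    (gamma (expDeformation A (leibniz m (-(ℓ : ℤ))))).map ddε =
      ∑ d ∈ Finset.range ℓ, (-1 : K n) ^ ((d : ℤ) - 1) •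
        (Psi A (ℓ - 1 - d) * m.map (algebraMap ℂ (K n)) * (Psi A d).transpose) := by
  ext i j
  rw [Matrix.map_apply, ddε_gamma_expDeformation hτ, leibniz_vac_eq_sum fun h => hm (by lia),
    neg_neg, Int.toNat_natCast, Matrix.sum_apply]
  simp only [map_sum, map_smul, Finset.sum_mul, Finset.mul_sum, smul_mul_assoc, mul_smul_comm,
    ← Finset.sum_sub_distrib, ← smul_sub, ← Finset.sum_neg_distrib, Finset.sum_div]
  refine Finset.sum_congr rfl fun d hd => ?_
  rw [Matrix.smul_apply, Matrix.mul_apply, smul_eq_mul, Finset.mul_sum, Finset.sum_comm]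
  refine Finset.sum_congr rfl fun b _ => ?_
  rw [Matrix.mul_apply, Finset.sum_mul, Finset.mul_sum]
  refine Finset.sum_congr rfl fun a _ => ?_
  have hdℓ := Finset.mem_range.1 hd
  have hdeg : (-1 : ℤ) - ((ℓ - 1 - d : ℕ) : ℤ) = d + -ℓ := by lia
  rw [hA.element_wedge_contract_vac hτ a b i j d (by lia), neg_one_zpow_natCast_sub_one,
    Matrix.transpose_apply, Matrix.map_apply, Psi_apply, Psi_apply, hdeg, Algebra.smul_def,
    Algebra.smul_def, map_mul, map_mul, map_mul, ← IsScalarTower.algebraMap_apply,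
    ← IsScalarTower.algebraMap_apply, map_pow, map_neg, map_one]
  ring

end IsSymplecticOp

end Variation

end VanDeLeur

end

theorem mainTheorem1_general (n ℓ : ℕ) (r s : Matrix (Fin n) (Fin n) ℂ)
    (hr : ℓ = 0 → r.trace = 0) (hs : ℓ = 0 → s.trace = 0)
    (A : VanDeLeur.Op n) (hA : VanDeLeur.IsSymplecticOp A)
    (hτ : VanDeLeur.matrixElement A VanDeLeur.vac VanDeLeur.vac ≠ 0) :
    (VanDeLeur.gamma
        (VanDeLeur.expDeformation A (VanDeLeur.leibniz r (-(ℓ : ℤ))))).map VanDeLeur.ddε =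
      ∑ p ∈ (Finset.range ℓ ×ˢ Finset.range ℓ).filter (fun p => p.1 + p.2 + 1 = ℓ),
        (-1 : VanDeLeur.K n) ^ ((p.2 : ℤ) - 1) •
          (VanDeLeur.Psi A p.1 * r.map (algebraMap ℂ (VanDeLeur.K n)) *
            (VanDeLeur.Psi A p.2).transpose) ∧
    (VanDeLeur.gamma
        (VanDeLeur.expDeformation A (VanDeLeur.leibniz s (ℓ : ℤ)))).map VanDeLeur.ddε = 0 := by
  rw [VanDeLeur.sum_filter_add_add_one_eq]
  exact ⟨hA.gamma_map_ddε_leibniz_neg hτ hr,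
    VanDeLeur.gamma_map_ddε_leibniz_of_nonneg hτ (fun h => hs (Int.natCast_eq_zero.1 h))
      (Int.natCast_nonneg ℓ)⟩

theorem mainTheorem1 (n ℓ : ℕ) (r s : Matrix (Fin n) (Fin n) ℂ)
    (hr : VanDeLeur.HasParity ℓ r) (hs : VanDeLeur.HasParity ℓ s)
    (A : VanDeLeur.Op n) (hA : VanDeLeur.IsSymplecticOp A)
    (hτ : VanDeLeur.matrixElement A VanDeLeur.vac VanDeLeur.vac ≠ 0) :
    VanDeLeur.NDEq
      ((VanDeLeur.gamma
        (VanDeLeur.expDeformation A (VanDeLeur.leibniz r (-(ℓ : ℤ))))).map VanDeLeur.ddε)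
      (∑ p ∈ (Finset.range ℓ ×ˢ Finset.range ℓ).filter (fun p => p.1 + p.2 + 1 = ℓ),
        (-1 : VanDeLeur.K n) ^ ((p.2 : ℤ) - 1) •
          (VanDeLeur.Psi A p.1 * r.map (algebraMap ℂ (VanDeLeur.K n)) *
            (VanDeLeur.Psi A p.2).transpose)) ∧
    VanDeLeur.NDEq
      ((VanDeLeur.gamma
        (VanDeLeur.expDeformation A (VanDeLeur.leibniz s (ℓ : ℤ)))).map VanDeLeur.ddε)
      0 := by
  obtain ⟨hγr, hγs⟩ := mainTheorem1_general n ℓ r s (fun h => hr.trace_eq_zero (h ▸ Even.zero))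
    (fun h => hs.trace_eq_zero (h ▸ Even.zero)) A hA hτ
  exact ⟨fun i j _ => congrFun₂ hγr i j, fun i j _ => congrFun₂ hγs i j⟩
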